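/- Let $k$ be an algebraically closed field and let $A=\bigoplus_{i\ge 0}A_i$ be a finite dimensional, non-negatively graded $k$-algebra. Let $\mathrm{ext}^\bullet_A$ be the Ext-bifunctor of the category of finite dimensional $\mathbb Z$-graded left $A$-modules with degree-preserving maps, and for such a module $M$ let $M\langle r\rangle$ be the shift with $M\langle r\rangle_i=M_{i-r}$. An $A_0$-module is regarded as a graded $A$-module concentrated in degree $0$ through the projection $A\to A_0$. Assume that $A_0$ is quasi-hereditary with weight poset $\Lambda$, with standard modules $\Delta^0(\lambda)$ and costandard modules $\nabla_0(\lambda)$, $\lambda\in\Lambda$. For $n\ge 0$, $A$ is called $n$-Q-Koszul if, for all $\lambda,\mu\in\Lambda$, all integers $0<i\le n$ and all $j\in\mathbb Z$, $\mathrm{ext}^i_A(\Delta^0(\lambda),\nabla_0(\mu)\langle j\rangle)\neq 0$ implies $i=j$. For a finite dimensional $A_0$-module $V$ let $\Omega_m(V)$ be the $m$th syzygy in a minimal projective resolution of $V$ over $A_0$, with $\Omega_0(V)=V$. An $A_0$-module has a $\Delta^0$-filtration if it has a finite filtration with sections isomorphic to modules $\Delta^0(\lambda)$, $\lambda\in\Lambda$.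 Assume that $A$ is $(n+1)$-Q-Koszul for some integer $n>0$, and let $s,r$ be integers with $0<s\le n$ and $s\le r$. (a) $\mathrm{Ext}^r_{A_0}(A_s,\nabla_0(\gamma))=0$ for all $\gamma\in\Lambda$. In particular, the left $A_0$-modules $\Omega_{r-1}(A_s),\Omega_r(A_s),\Omega_{r+1}(A_s),\dots$ all have $\Delta^0$-filtrations; consequently (case $r=s$), so do $\Omega_{s-1}(A_s),\Omega_s(A_s),\Omega_{s+1}(A_s),\dots$. (b) Assume also $r\le n+1$, and let $m$ be any integer with $m\le r$. Then $\mathrm{ext}^r_A(A_s,\nabla_0(\nu)\langle m\rangle)=0$ for all $\nu\in\Lambda$, where $A_s=A_{\ge s}/A_{>s}$ is the graded $A$-module concentrated in degree $s$. -/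

import Mathlib

open CategoryTheory

universe u v w

/-! ### Graded modules over a non-negatively graded algebra -/

/-- A finitely generated `ℤ`-graded left module `M = ⨁ M_j` over the `ℕ`-graded algebra
`A = ⨁ 𝒜 i`. (If `A` is finite dimensional over `k`, finitely generated is the same as finite
dimensional, and each `M_j` is automatically a `k`-subspace because `k · 1 ⊆ 𝒜 0`.) -/
structure GrMod {k : Type v} {A : Type u} [Field k] [Ring A] [Algebra k A]
    (𝒜 : ℕ → Submodule k A) where
  carrier : Type u
  [addCommGroup : AddCommGroup carrier]
  [module : Module A carrier]
  [finite : Module.Finite A carrier]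
  /-- the homogeneous components -/
  deg : ℤ → AddSubgroup carrier
  isInternal : DirectSum.IsInternal deg
  smul_mem : ∀ (i : ℕ) (j : ℤ) (a : A) (m : carrier),
    a ∈ 𝒜 i → m ∈ deg j → a • m ∈ deg ((i : ℤ) + j)

namespace GrMod

attribute [instance] GrMod.addCommGroup GrMod.module GrMod.finite

/-- A criterion for an internal direct sum decomposition: there are projections onto the
pieces. -/
theorem isInternal_of_proj {N : Type u} [AddCommGroup N] (D : ℤ → AddSubgroup N)
    (p : ℤ → N →+ N) (h1 : ∀ i x, x ∈ D i → p i x = x)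
    (h2 : ∀ i j x, x ∈ D i → i ≠ j → p j x = 0) (h3 : ∀ x, x ∈ ⨆ i, D i) :
    DirectSum.IsInternal D := by
  constructor
  · rw [injective_iff_map_eq_zero]
    intro f hf
    have key : ∀ (j : ℤ) (g : DirectSum ℤ fun i => D i),
        p j (DirectSum.coeAddMonoidHom D g) = (g j : N) := by
      intro j g
      induction g using DirectSum.induction_on with
      | zero => simp
      | of i x =>
        rw [DirectSum.coeAddMonoidHom_of]
        by_cases hij : i = j
        · subst hij
          rw [DirectSum.of_eq_same]
          exact h1 _ _ x.2
        · rw [DirectSum.of_eq_of_ne _ _ _ (Ne.symm hij), h2 i j x x.2 hij]; rfl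
      | add a b ha hb => simp [map_add, ha, hb]
    ext j
    rw [← key j f, hf]; simp
  · intro x
    have hle : ⨆ i, D i ≤ (DirectSum.coeAddMonoidHom D).range :=
      iSup_le fun i y hy => ⟨DirectSum.of (fun i => D i) i ⟨y, hy⟩, by simp⟩
    exact hle (h3 x)

variable {k : Type v} {A : Type u} [Field k] [Ring A] [Algebra k A] {𝒜 : ℕ → Submodule k A}

theorem mem_iSup (M : GrMod 𝒜) (x : M.carrier) : x ∈ ⨆ i, M.deg i := by
  obtain ⟨f, rfl⟩ := M.isInternal.2 x
  induction f using DirectSum.induction_on with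
  | zero => simp
  | of i x =>
    rw [DirectSum.coeAddMonoidHom_of]
    exact AddSubgroup.mem_iSup_of_mem i x.2
  | add a b ha hb => rw [map_add]; exact add_mem ha hb

/-- The projection of a graded module onto its component of degree `i`. -/
noncomputable def proj (M : GrMod 𝒜) (i : ℤ) : M.carrier →+ M.carrier :=
  letI := M.isInternal.chooseDecomposition
  { toFun := fun x => (DirectSum.decompose M.deg x i : M.carrier)
    map_zero' := by simp
    map_add' := by simp }

theorem proj_mem (M : GrMod 𝒜) (i : ℤ) (x : M.carrier) : M.proj i x ∈ M.deg i := by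
  let := M.isInternal.chooseDecomposition
  exact (DirectSum.decompose M.deg x i).2

theorem proj_of_mem (M : GrMod 𝒜) {i : ℤ} {x : M.carrier} (hx : x ∈ M.deg i) :
    M.proj i x = x := by
  let := M.isInternal.chooseDecomposition
  exact DirectSum.decompose_of_mem_same M.deg hx

theorem proj_of_mem_ne (M : GrMod 𝒜) {i j : ℤ} {x : M.carrier} (hx : x ∈ M.deg i)
    (hij : i ≠ j) : M.proj j x = 0 := by
  let := M.isInternal.chooseDecomposition
  exact DirectSum.decompose_of_mem_ne M.deg hx hij

theorem exists_sum_proj (M : GrMod 𝒜) (x : M.carrier) :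
    ∃ s : Finset ℤ, x = ∑ i ∈ s, M.proj i x := by
  classical
  let := M.isInternal.chooseDecomposition
  exact ⟨_, (DirectSum.sum_support_decompose M.deg x).symm⟩

theorem map_proj {M N : GrMod 𝒜} (f : M.carrier →ₗ[A] N.carrier)
    (hf : ∀ i x, x ∈ M.deg i → f x ∈ N.deg i) (i : ℤ) (x : M.carrier) :
    f (M.proj i x) = N.proj i (f x) := by
  induction M.mem_iSup x using AddSubgroup.iSup_induction' with
  | hp j y hy =>
    by_cases hij : j = i
    · subst hij; rw [M.proj_of_mem hy, N.proj_of_mem (hf _ _ hy)]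
    · rw [M.proj_of_mem_ne hy hij, N.proj_of_mem_ne (hf _ _ hy) hij, map_zero]
  | h1 => simp
  | hadd a b _ _ ha hb => simp [ha, hb]

/-! #### The category of graded modules -/

/-- Homomorphisms of graded modules: `A`-linear maps preserving degrees. -/
def homs (M N : GrMod 𝒜) : AddSubgroup (M.carrier →ₗ[A] N.carrier) where
  carrier := {f | ∀ i x, x ∈ M.deg i → f x ∈ N.deg i}
  zero_mem' := fun i _ _ => zero_mem (N.deg i)
  add_mem' := fun hf hg i x hx => add_mem (hf i x hx) (hg i x hx)
  neg_mem' := fun hf i x hx => neg_mem (hf i x hx)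

instance : Category.{u} (GrMod 𝒜) where
  Hom M N := homs M N
  id M := ⟨LinearMap.id, fun _ _ hx => hx⟩
  comp f g := ⟨g.1 ∘ₗ f.1, fun i x hx => g.2 i _ (f.2 i x hx)⟩

/-- The linear map underlying a morphism of graded modules. -/
def Hom.lin {M N : GrMod 𝒜} (f : M ⟶ N) : M.carrier →ₗ[A] N.carrier := f.1

/-- Build a morphism of graded modules from a degree preserving linear map. -/
def Hom.mk {M N : GrMod 𝒜} (f : M.carrier →ₗ[A] N.carrier)
    (hf : ∀ i x, x ∈ M.deg i → f x ∈ N.deg i) : M ⟶ N := ⟨f, hf⟩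

@[ext] theorem Hom.ext' {M N : GrMod 𝒜} {f g : M ⟶ N} (h : Hom.lin f = Hom.lin g) : f = g :=
  Subtype.ext h

theorem Hom.mem {M N : GrMod 𝒜} (f : M ⟶ N) : ∀ i x, x ∈ M.deg i → Hom.lin f x ∈ N.deg i := f.2

@[simp] theorem lin_mk {M N : GrMod 𝒜} (f : M.carrier →ₗ[A] N.carrier)
    (hf : ∀ i x, x ∈ M.deg i → f x ∈ N.deg i) : Hom.lin (Hom.mk f hf) = f := rfl

@[simp] theorem lin_id (M : GrMod 𝒜) : Hom.lin (𝟙 M) = LinearMap.id := rfl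

@[simp] theorem lin_comp {M N P : GrMod 𝒜} (f : M ⟶ N) (g : N ⟶ P) :
    Hom.lin (f ≫ g) = Hom.lin g ∘ₗ Hom.lin f := rfl

instance : Preadditive (GrMod 𝒜) where
  homGroup M N := inferInstanceAs (AddCommGroup (homs M N))
  add_comp := by
    intro M N P f f' g
    apply Subtype.ext
    exact LinearMap.ext fun x => map_add g.1 _ _
  comp_add := by
    intro M N P f g g'
    apply Subtype.ext
    exact LinearMap.ext fun x => rfl

@[simp] theorem lin_zero (M N : GrMod 𝒜) : Hom.lin (0 : M ⟶ N) = 0 := rfl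

@[simp] theorem lin_add {M N : GrMod 𝒜} (f g : M ⟶ N) :
    Hom.lin (f + g) = Hom.lin f + Hom.lin g := rfl

/-- A homogeneous submodule, as a graded module. -/
def sub [IsNoetherianRing A] (M : GrMod 𝒜) (S : Submodule A M.carrier)
    (hS : ∀ i x, x ∈ S → M.proj i x ∈ S) : GrMod 𝒜 where
  carrier := S
  deg i := (M.deg i).comap S.subtype.toAddMonoidHom
  isInternal := by
    refine isInternal_of_proj _ (fun i => ((M.proj i).comp S.subtype.toAddMonoidHom).codRestrict
      S.toAddSubgroup (fun x => hS i x x.2)) ?_ ?_ ?_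
    · intro i x hx
      exact Subtype.ext (M.proj_of_mem hx)
    · intro i j x hx hij
      exact Subtype.ext (M.proj_of_mem_ne hx hij)
    · intro x
      obtain ⟨s, hs⟩ := M.exists_sum_proj x.1
      have : x = ∑ i ∈ s, (⟨M.proj i x.1, hS i _ x.2⟩ : S) := by
        apply Subtype.ext
        simpa using hs
      rw [this]
      exact sum_mem fun i _ => AddSubgroup.mem_iSup_of_mem i (M.proj_mem i x.1)
  smul_mem i j a m ha hm := M.smul_mem i j a m ha hm

/-- The quotient by a homogeneous submodule, as a graded module. -/
def quot (M : GrMod 𝒜) (S : Submodule A M.carrier)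
    (hS : ∀ i x, x ∈ S → M.proj i x ∈ S) : GrMod 𝒜 where
  carrier := M.carrier ⧸ S
  deg i := (M.deg i).map S.mkQ.toAddMonoidHom
  isInternal := by
    refine isInternal_of_proj _ (fun i => QuotientAddGroup.map S.toAddSubgroup S.toAddSubgroup
      (M.proj i) (fun x hx => hS i x hx)) ?_ ?_ ?_
    · rintro i _ ⟨x, hx, rfl⟩
      exact congrArg S.mkQ (M.proj_of_mem hx)
    · rintro i j _ ⟨x, hx, rfl⟩ hij
      exact (congrArg S.mkQ (M.proj_of_mem_ne hx hij)).trans (map_zero _)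
    · intro x
      obtain ⟨x, rfl⟩ := S.mkQ_surjective x
      obtain ⟨s, hs⟩ := M.exists_sum_proj x
      rw [hs, map_sum]
      exact sum_mem fun i _ => AddSubgroup.mem_iSup_of_mem i ⟨_, M.proj_mem i x, rfl⟩
  smul_mem := by
    rintro i j a _ ha ⟨m, hm, rfl⟩
    exact ⟨a • m, M.smul_mem i j a m ha hm, map_smul S.mkQ a m⟩

/-- The direct sum of two graded modules. -/
def prod (M N : GrMod 𝒜) : GrMod 𝒜 where
  carrier := M.carrier × N.carrier
  deg i := (M.deg i).prod (N.deg i)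
  isInternal := by
    refine isInternal_of_proj _ (fun i => (M.proj i).prodMap (N.proj i)) ?_ ?_ ?_
    · rintro i ⟨x, y⟩ ⟨hx, hy⟩
      exact Prod.ext (M.proj_of_mem hx) (N.proj_of_mem hy)
    · rintro i j ⟨x, y⟩ ⟨hx, hy⟩ hij
      exact Prod.ext (M.proj_of_mem_ne hx hij) (N.proj_of_mem_ne hy hij)
    · rintro ⟨x, y⟩
      have h1 : AddMonoidHom.inl M.carrier N.carrier x ∈
          ⨆ i, (M.deg i).prod (N.deg i) := by
        obtain ⟨s, hs⟩ := M.exists_sum_proj x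
        rw [hs, map_sum]
        exact sum_mem fun i _ => AddSubgroup.mem_iSup_of_mem i ⟨M.proj_mem i x, zero_mem _⟩
      have h2 : AddMonoidHom.inr M.carrier N.carrier y ∈
          ⨆ i, (M.deg i).prod (N.deg i) := by
        obtain ⟨s, hs⟩ := N.exists_sum_proj y
        rw [hs, map_sum]
        exact sum_mem fun i _ => AddSubgroup.mem_iSup_of_mem i ⟨zero_mem _, N.proj_mem i y⟩
      have := add_mem h1 h2
      simpa using this
  smul_mem i j a m ha hm := ⟨M.smul_mem i j a _ ha hm.1, N.smul_mem i j a _ ha hm.2⟩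

/-- The zero graded module. -/
def zero (𝒜 : ℕ → Submodule k A) : GrMod 𝒜 where
  carrier := PUnit.{u + 1}
  deg _ := ⊤
  isInternal := by
    refine isInternal_of_proj _ (fun _ => 0) ?_ ?_ ?_
    · intros; rfl
    · intros; rfl
    · intro x; exact zero_mem _
  smul_mem := by intros; trivial

theorem zero_isZero (𝒜 : ℕ → Submodule k A) : Limits.IsZero (zero 𝒜) := by
  rw [Limits.IsZero.iff_id_eq_zero]
  exact Hom.ext' (LinearMap.ext fun _ => rfl)

instance : Limits.HasZeroObject (GrMod 𝒜) := ⟨⟨_, zero_isZero 𝒜⟩⟩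

instance : Limits.HasBinaryBiproducts (GrMod 𝒜) where
  has_binary_biproduct M N := Limits.HasBinaryBiproduct.mk
    { bicone :=
        { pt := prod M N
          fst := Hom.mk (LinearMap.fst A _ _) fun _ _ hx => hx.1
          snd := Hom.mk (LinearMap.snd A _ _) fun _ _ hx => hx.2
          inl := Hom.mk (LinearMap.inl A _ _) fun _ _ hx => ⟨hx, zero_mem _⟩
          inr := Hom.mk (LinearMap.inr A _ _) fun _ _ hx => ⟨zero_mem _, hx⟩
          inl_fst := rfl
          inl_snd := rfl
          inr_fst := rfl
          inr_snd := rfl }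
      isBilimit := Limits.isBinaryBilimitOfTotal _ (by
        apply Hom.ext'
        apply LinearMap.ext
        rintro ⟨x, y⟩
        exact Prod.ext (add_zero x) (zero_add y)) }

instance : Limits.HasFiniteProducts (GrMod 𝒜) :=
  hasFiniteProducts_of_has_binary_and_terminal

section kernels

variable {M N : GrMod 𝒜} (f : M ⟶ N)

/-- The kernel of a morphism. -/
def ker [IsNoetherianRing A] : GrMod 𝒜 := M.sub (LinearMap.ker (Hom.lin f)) (by
  intro i x hx
  rw [LinearMap.mem_ker] at hx ⊢
  rw [map_proj _ (Hom.mem f), hx, map_zero])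

/-- The inclusion of the kernel. -/
def kerι [IsNoetherianRing A] : ker f ⟶ M := Hom.mk (LinearMap.ker (Hom.lin f)).subtype fun _ _ hx => hx

theorem kerι_comp [IsNoetherianRing A] : kerι f ≫ f = 0 := by
  apply Hom.ext'
  apply LinearMap.ext
  intro x
  exact x.2

theorem mono_of_injective (h : Function.Injective (Hom.lin f)) : Mono f where
  right_cancellation g g' e := by
    apply Hom.ext'
    apply LinearMap.ext
    intro x
    exact h (LinearMap.congr_fun (congrArg Hom.lin e) x)

theorem epi_of_surjective (h : Function.Surjective (Hom.lin f)) : Epi f where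
  left_cancellation g g' e := by
    apply Hom.ext'
    apply LinearMap.ext
    intro x
    obtain ⟨x, rfl⟩ := h x
    exact LinearMap.congr_fun (congrArg Hom.lin e) x

theorem injective_of_mono [IsNoetherianRing A] [Mono f] : Function.Injective (Hom.lin f) := by
  have h : kerι f = 0 := by
    rw [← cancel_mono f, kerι_comp, Limits.zero_comp]
  rw [injective_iff_map_eq_zero]
  intro x hx
  exact LinearMap.congr_fun (congrArg Hom.lin h) (⟨x, hx⟩ : LinearMap.ker (Hom.lin f))

instance [IsNoetherianRing A] : Mono (kerι f) := mono_of_injective _ Subtype.val_injective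

/-- The kernel is a kernel in the categorical sense. -/
def kerIsLimit [IsNoetherianRing A] : Limits.IsLimit (Limits.KernelFork.ofι (kerι f) (kerι_comp f)) :=
  Limits.KernelFork.IsLimit.ofι' _ _ fun g hg =>
    ⟨Hom.mk (LinearMap.codRestrict _ (Hom.lin g)
      (fun x => LinearMap.congr_fun (congrArg Hom.lin hg) x)) (fun i x hx => Hom.mem g i x hx),
      rfl⟩

/-- The cokernel of a morphism. -/
def coker : GrMod 𝒜 := N.quot (LinearMap.range (Hom.lin f)) (by
  rintro i _ ⟨x, rfl⟩
  exact ⟨M.proj i x, map_proj _ (Hom.mem f) i x⟩)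

/-- The projection to the cokernel. -/
def cokerπ : N ⟶ coker f :=
  Hom.mk (LinearMap.range (Hom.lin f)).mkQ fun _ x hx => ⟨x, hx, rfl⟩

theorem comp_cokerπ : f ≫ cokerπ f = 0 := by
  apply Hom.ext'
  apply LinearMap.ext
  intro x
  exact (Submodule.Quotient.mk_eq_zero _).2 ⟨x, rfl⟩

theorem surjective_of_epi [Epi f] : Function.Surjective (Hom.lin f) := by
  have h : cokerπ f = 0 := by
    rw [← cancel_epi f, comp_cokerπ, Limits.comp_zero]
  intro y
  exact (Submodule.Quotient.mk_eq_zero _).1 (LinearMap.congr_fun (congrArg Hom.lin h) y)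

instance : Epi (cokerπ f) := epi_of_surjective _ (Submodule.mkQ_surjective _)

/-- The cokernel is a cokernel in the categorical sense. -/
def cokerIsColimit : Limits.IsColimit (Limits.CokernelCofork.ofπ (cokerπ f) (comp_cokerπ f)) :=
  Limits.CokernelCofork.IsColimit.ofπ' _ _ fun g hg =>
    ⟨Hom.mk ((LinearMap.range (Hom.lin f)).liftQ (Hom.lin g) (by
        rintro _ ⟨x, rfl⟩
        exact LinearMap.congr_fun (congrArg Hom.lin hg) x))
      (by
        rintro i _ ⟨x, hx, rfl⟩
        exact Hom.mem g i x hx), rfl⟩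

/-- A monomorphism is the kernel of its cokernel. -/
@[reducible]
noncomputable def normalMono [IsNoetherianRing A] [Mono f] : NormalMono f where
  Z := coker f
  g := cokerπ f
  w := comp_cokerπ f
  isLimit := Limits.KernelFork.IsLimit.ofι' _ _ fun {W} g hg => by
    have hinj := injective_of_mono f
    have hr : ∀ x, Hom.lin g x ∈ LinearMap.range (Hom.lin f) := fun x =>
      (Submodule.Quotient.mk_eq_zero _).1 (LinearMap.congr_fun (congrArg Hom.lin hg) x)
    let e := LinearEquiv.ofInjective (Hom.lin f) hinj
    let l : W.carrier →ₗ[A] M.carrier :=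
      e.symm.toLinearMap ∘ₗ LinearMap.codRestrict _ (Hom.lin g) hr
    have hl : ∀ x, Hom.lin f (l x) = Hom.lin g x := fun x =>
      congrArg Subtype.val (e.apply_symm_apply ⟨Hom.lin g x, hr x⟩)
    refine ⟨Hom.mk l fun i x hx => ?_, ?_⟩
    · have h1 : M.proj i (l x) = l x := by
        apply hinj
        rw [map_proj _ (Hom.mem f), hl, N.proj_of_mem (Hom.mem g i x hx)]
      rw [← h1]
      exact M.proj_mem i _
    · apply Hom.ext'
      apply LinearMap.ext
      exact hl

/-- An epimorphism is the cokernel of its kernel. -/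
@[reducible]
noncomputable def normalEpi [IsNoetherianRing A] [Epi f] : NormalEpi f where
  W := ker f
  g := kerι f
  w := kerι_comp f
  isColimit := Limits.CokernelCofork.IsColimit.ofπ' _ _ fun {W} g hg => by
    have hsurj := surjective_of_epi f
    have hk : LinearMap.ker (Hom.lin f) ≤ LinearMap.ker (Hom.lin g) := fun x hx =>
      LinearMap.congr_fun (congrArg Hom.lin hg) (⟨x, hx⟩ : LinearMap.ker (Hom.lin f))
    let e := LinearMap.quotKerEquivOfSurjective (Hom.lin f) hsurj
    let l : N.carrier →ₗ[A] W.carrier :=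
      (LinearMap.ker (Hom.lin f)).liftQ (Hom.lin g) hk ∘ₗ e.symm.toLinearMap
    have hl : ∀ x, l (Hom.lin f x) = Hom.lin g x := fun x => by
      have : e.symm (Hom.lin f x) = Submodule.Quotient.mk x := by
        rw [LinearEquiv.symm_apply_eq]; rfl
      change (LinearMap.ker (Hom.lin f)).liftQ (Hom.lin g) hk (e.symm (Hom.lin f x)) = _
      rw [this]; rfl
    refine ⟨Hom.mk l fun i x hx => ?_, ?_⟩
    · obtain ⟨y, rfl⟩ := hsurj x
      have h1 : Hom.lin f y = Hom.lin f (M.proj i y) := by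
        rw [map_proj _ (Hom.mem f), N.proj_of_mem hx]
      rw [h1, hl]
      exact Hom.mem g i _ (M.proj_mem i y)
    · apply Hom.ext'
      apply LinearMap.ext
      exact hl

end kernels

section abelian

variable [IsNoetherianRing A]

instance : Limits.HasKernels (GrMod 𝒜) where
  has_limit f := ⟨⟨⟨_, kerIsLimit f⟩⟩⟩

instance : Limits.HasCokernels (GrMod 𝒜) where
  has_colimit f := ⟨⟨⟨_, cokerIsColimit f⟩⟩⟩

/-- The category of finitely generated graded modules over a (left) Noetherian graded algebra
is abelian. -/
instance : Abelian (GrMod 𝒜) where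
  normalMonoOfMono f _ := ⟨normalMono f⟩
  normalEpiOfEpi f _ := ⟨normalEpi f⟩

instance : HasExt.{u + 1} (GrMod 𝒜) := HasExt.standard _

end abelian

/-- The grading shift: `M⟨r⟩` has components `M⟨r⟩_i = M_{i - r}`. -/
def shift (M : GrMod 𝒜) (r : ℤ) : GrMod 𝒜 where
  carrier := M.carrier
  deg i := M.deg (i - r)
  isInternal := by
    refine isInternal_of_proj _ (fun i => M.proj (i - r)) ?_ ?_ ?_
    · intro i x hx
      exact M.proj_of_mem hx
    · intro i j x hx hij
      exact M.proj_of_mem_ne hx (by omega)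
    · intro x
      have h := M.mem_iSup x
      rwa [← (Equiv.subRight r).iSup_comp] at h
  smul_mem i j a m ha hm := by
    have := M.smul_mem i (j - r) a m ha hm
    rwa [← add_sub_assoc] at this

/-- A finitely generated `𝒜 0`-module `X`, regarded as a graded `A`-module concentrated in degree
`0` on which `A` acts through the projection `A → 𝒜 0` (which kills `𝒜 i` for `i > 0`). -/
noncomputable def inflate [GradedAlgebra 𝒜] (X : FGModuleCat.{u} (𝒜 0)) : GrMod 𝒜 :=
  letI : Module A X := Module.compHom X (GradedRing.projZeroRingHom' 𝒜)
  { carrier := X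
    finite := by
      obtain ⟨S, hS⟩ := (inferInstance : Module.Finite (𝒜 0) X)
      refine ⟨S, eq_top_iff.2 fun x _ => ?_⟩
      have hx : x ∈ Submodule.span (𝒜 0) (S : Set X) := hS ▸ trivial
      induction hx using Submodule.span_induction with
      | mem x h => exact Submodule.subset_span h
      | zero => exact zero_mem _
      | add x y _ _ hx hy => exact add_mem (hx trivial) (hy trivial)
      | smul a x _ hx =>
        have h1 : (a : A) • x = a • x :=
          congrArg (fun b : 𝒜 0 => b • x) (GradedRing.projZeroRingHom'_apply_coe 𝒜 a)
        rw [← h1]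
        exact Submodule.smul_mem _ _ (hx trivial)
    deg := fun i => if i = 0 then ⊤ else ⊥
    isInternal := by
      refine isInternal_of_proj _ (fun i => if i = 0 then AddMonoidHom.id _ else 0) ?_ ?_ ?_
      · intro i x hx
        split_ifs at hx ⊢
        · rfl
        · exact (AddSubgroup.mem_bot.1 hx).symm
      · intro i j x hx hij
        by_cases hj : j = 0
        · rw [if_neg (by omega)] at hx
          rw [AddSubgroup.mem_bot.1 hx, map_zero]
        · rw [if_neg hj]; rfl
      · intro x
        refine AddSubgroup.mem_iSup_of_mem 0 ?_
        simp
    smul_mem := by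
      intro i j a m ha hm
      by_cases hj : j = 0
      · by_cases hi : i = 0
        · subst hi hj; simp
        · have h0 : GradedRing.projZeroRingHom' 𝒜 a = 0 := by
            apply Subtype.ext
            exact DirectSum.decompose_of_mem_ne 𝒜 ha hi
          have h1 : a • m = 0 := by
            change GradedRing.projZeroRingHom' 𝒜 a • m = 0
            rw [h0, zero_smul]
          rw [h1]; exact zero_mem _
      · rw [if_neg hj] at hm
        rw [AddSubgroup.mem_bot.1 hm, smul_zero]
        exact zero_mem _ }

end GrMod

/-! ### Modules over a ring: composition factors, covers, hulls, filtrations, syzygies -/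

section ModuleTheory

variable {R : Type u} [Ring R]

/-- `S` (a simple module) is a composition factor of the (finite length) module `M`: it is
isomorphic to a subquotient `N₂ / N₁` of `M`. -/
def IsCompositionFactor (S : Type u) [AddCommGroup S] [Module R S]
    (M : Type u) [AddCommGroup M] [Module R M] : Prop :=
  ∃ N₁ N₂ : Submodule R M, N₁ ≤ N₂ ∧ Nonempty ((N₂ ⧸ N₁.submoduleOf N₂) ≃ₗ[R] S)

/-- `p : P → M` is a projective cover: `P` is projective, `p` is surjective and its kernel is
superfluous. -/
structure IsProjectiveCover {P M : Type u} [AddCommGroup P] [Module R P]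
    [AddCommGroup M] [Module R M] (p : P →ₗ[R] M) : Prop where
  projective : Module.Projective R P
  surjective : Function.Surjective p
  superfluous : ∀ N : Submodule R P, N ⊔ LinearMap.ker p = ⊤ → N = ⊤

/-- `i : M → I` is an injective hull: `I` is injective, `i` is injective and its image is
essential. -/
structure IsInjectiveHull {M I : Type u} [AddCommGroup M] [Module R M]
    [AddCommGroup I] [Module R I] (i : M →ₗ[R] I) : Prop where
  injective_module : Module.Injective R I
  injective : Function.Injective i
  essential : ∀ N : Submodule R I, N ⊓ LinearMap.range i = ⊥ → N = ⊥

/-- `M` has a finite filtration `0 = F 0 ≤ F 1 ≤ ⋯ ≤ F n = M` whose sections are isomorphic to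
modules `D ν` with `ν ∈ T`. -/
def HasFiltration {Λ : Type w} (D : Λ → FGModuleCat.{u} R) (T : Set Λ)
    (M : Type u) [AddCommGroup M] [Module R M] : Prop :=
  ∃ (n : ℕ) (F : ℕ → Submodule R M), F 0 = ⊥ ∧ F n = ⊤ ∧
    ∀ i < n, F i ≤ F (i + 1) ∧
      ∃ ν ∈ T, Nonempty ((F (i + 1) ⧸ (F i).submoduleOf (F (i + 1))) ≃ₗ[R] D ν)

/-- `IsSyzygy m V W`: the module `W` is (isomorphic to) the `m`th syzygy `Ω_m(V)` of `V`, the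
`m`th kernel in a minimal projective resolution `⋯ → P¹ → P⁰ → V → 0`, with `Ω_0(V) = V`. -/
inductive IsSyzygy (V : FGModuleCat.{u} R) : ℕ → FGModuleCat.{u} R → Prop
  | zero (W : FGModuleCat.{u} R) (e : V ≃ₗ[R] W) : IsSyzygy V 0 W
  | succ (m : ℕ) (U P W : FGModuleCat.{u} R) (hU : IsSyzygy V m U) (p : P →ₗ[R] U)
      (hp : IsProjectiveCover p) (e : LinearMap.ker p ≃ₗ[R] W) : IsSyzygy V (m + 1) W

/-! ### Quasi-hereditary algebras -/

variable {Λ : Type w} [PartialOrder Λ]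

/-- All composition factors of `M` among the `L ν` satisfy `ν ≤ μ`. -/
def FactorsLE (L : Λ → FGModuleCat.{u} R) (μ : Λ)
    (M : Type u) [AddCommGroup M] [Module R M] : Prop :=
  ∀ ν, IsCompositionFactor (R := R) (L ν) M → ν ≤ μ

/-- `D` is the standard module `Δ(μ)`: the largest quotient of the projective cover `P(μ)` of
`L(μ)` all of whose composition factors are of the form `L(ν)` with `ν ≤ μ`. -/
def IsStandardModule (L : Λ → FGModuleCat.{u} R) (μ : Λ) (D : FGModuleCat.{u} R) : Prop :=
  ∃ (P : FGModuleCat.{u} R) (p : P →ₗ[R] L μ) (q : P →ₗ[R] D),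
    IsProjectiveCover p ∧ Function.Surjective q ∧ FactorsLE L μ D ∧
      ∀ K : Submodule R P, FactorsLE L μ (P ⧸ K) → LinearMap.ker q ≤ K

/-- `D` is the costandard module `∇(μ)`: the largest submodule of the injective hull `I(μ)` of
`L(μ)` all of whose composition factors are of the form `L(ν)` with `ν ≤ μ`. -/
def IsCostandardModule (L : Λ → FGModuleCat.{u} R) (μ : Λ) (D : FGModuleCat.{u} R) : Prop :=
  ∃ (I : FGModuleCat.{u} R) (i : L μ →ₗ[R] I) (j : D →ₗ[R] I),
    IsInjectiveHull i ∧ Function.Injective j ∧ FactorsLE L μ D ∧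
      ∀ K : Submodule R I, FactorsLE L μ K → K ≤ LinearMap.range j

/-- The (finite dimensional) algebra `R` is quasi-hereditary with weight poset `Λ`, irreducible
modules `L`, standard modules `Δ` and costandard modules `nab` (that is, `∇`). -/
structure IsQuasiHereditary (L Δ nab : Λ → FGModuleCat.{u} R) : Prop where
  /-- `Λ` indexes the isomorphism classes of irreducible modules. -/
  simple : ∀ μ, IsSimpleModule R (L μ)
  eq_of_equiv : ∀ μ ν, Nonempty (L μ ≃ₗ[R] L ν) → μ = ν
  exhaustive : ∀ S : FGModuleCat.{u} R, IsSimpleModule R S → ∃ μ, Nonempty (S ≃ₗ[R] L μ)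
  standard : ∀ μ, IsStandardModule L μ (Δ μ)
  costandard : ∀ μ, IsCostandardModule L μ (nab μ)
  /-- `L(μ)` occurs exactly once in `Δ(μ)`, as its head. -/
  head : ∀ μ, ∃ f : Δ μ →ₗ[R] L μ, Function.Surjective f ∧
    ∀ ν, IsCompositionFactor (R := R) (L ν) (LinearMap.ker f) → ν < μ
  /-- The kernel of `P(μ) → Δ(μ)` is filtered by standard modules `Δ(ν)` with `ν > μ`. -/
  filtration : ∀ μ, ∃ (P : FGModuleCat.{u} R) (p : P →ₗ[R] L μ) (q : P →ₗ[R] Δ μ),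
    IsProjectiveCover p ∧ Function.Surjective q ∧
      HasFiltration Δ {ν | μ < ν} (LinearMap.ker q)

end ModuleTheory

/-! ### Q-Koszul algebras -/

section QKoszul

variable {k : Type v} {A : Type u} [Field k] [Ring A] [Algebra k A] [FiniteDimensional k A]
  (𝒜 : ℕ → Submodule k A) [GradedAlgebra 𝒜]

instance isNoetherianRing_degreeZero : IsNoetherianRing (𝒜 0) :=
  haveI : IsScalarTower k (𝒜 0) (𝒜 0) :=
    ⟨fun c a b => Subtype.ext (smul_mul_assoc c (a : A) (b : A))⟩
  IsNoetherianRing.of_finite k (𝒜 0)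

noncomputable instance : HasExt.{u + 1} (FGModuleCat.{u} (𝒜 0)) := HasExt.standard _

/-- The homogeneous component `A_s` as a left module over `A_0`, by multiplication in `A`. -/
@[reducible]
def pieceModule (s : ℕ) : Module (𝒜 0) (𝒜 s) where
  smul a x := ⟨(a : A) * (x : A), by
    simpa using SetLike.mul_mem_graded a.2 x.2⟩
  one_smul x := Subtype.ext (one_mul (x : A))
  mul_smul a b x := Subtype.ext (mul_assoc (a : A) (b : A) (x : A))
  smul_zero a := Subtype.ext (mul_zero (a : A))
  smul_add a x y := Subtype.ext (mul_add (a : A) (x : A) (y : A))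
  add_smul a b x := Subtype.ext (add_mul (a : A) (b : A) (x : A))
  zero_smul x := Subtype.ext (zero_mul (x : A))

/-- The left `A_0`-module `A_s`. -/
noncomputable def piece (s : ℕ) : FGModuleCat.{u} (𝒜 0) :=
  letI := pieceModule 𝒜 s
  haveI : IsScalarTower k (𝒜 0) (𝒜 s) :=
    ⟨fun c a x => Subtype.ext (smul_mul_assoc c (a : A) (x : A))⟩
  haveI : Module.Finite (𝒜 0) (𝒜 s) := Module.Finite.of_restrictScalars_finite k (𝒜 0) (𝒜 s)
  FGModuleCat.of (𝒜 0) (𝒜 s)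

/-- `Ext^r_{A_0}(X, Y)`, computed in the category of finite dimensional `A_0`-modules. -/
abbrev ExtZero (r : ℕ) (X Y : FGModuleCat.{u} (𝒜 0)) : Type (u + 1) :=
  Abelian.Ext.{u + 1} X Y r

variable {𝒜} in
/-- `ext^r_A(M, N)`, computed in the category of finite dimensional graded `A`-modules. -/
abbrev ExtGr (r : ℕ) (M N : GrMod 𝒜) : Type (u + 1) :=
  haveI : IsNoetherianRing A := IsNoetherianRing.of_finite k A
  Abelian.Ext.{u + 1} M N r

/-- The graded algebra `A = ⨁ 𝒜 i` is `n`-Q-Koszul (with respect to the irreducible, standard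
and costandard modules `L`, `Δ`, `nab` of `A_0`): `A_0` is quasi-hereditary, and for `0 < i ≤ n`
and `j ∈ ℤ`, `ext^i_A(Δ(μ), ∇(ν)⟨j⟩) ≠ 0` implies `i = j`. -/
structure IsQKoszul (n : ℕ) {Λ : Type w} [PartialOrder Λ]
    (L Δ nab : Λ → FGModuleCat.{u} (𝒜 0)) : Prop where
  quasiHereditary : IsQuasiHereditary L Δ nab
  ext_ne_zero : ∀ (μ ν : Λ) (i : ℕ) (j : ℤ), 0 < i → i ≤ n →
    Nontrivial (ExtGr i (GrMod.inflate (Δ μ)) ((GrMod.inflate (nab ν)).shift j)) → (i : ℤ) = j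

end QKoszul

/-! Part (a) reduces to the single vanishing Ext^s(A_s, ∇) = 0 over A_0. The case i = 1, j = 0 of
the Q-Koszul condition, together with the embedding of Ext¹ over A_0 into graded ext¹, gives Ext¹(Δ,
∇) = 0. The Δ-filtered kernel of P(μ) → Δ(μ) then gives Ext^i(Δ, ∇) = 0 for all i > 0, and a module
M with Ext¹(M, ∇) = 0 for every ∇ is Δ-filtered (`hasFiltration_of_ext_one`). Hence vanishing of
Ext(M, ∇) in one positive degree persists in all higher degrees, and dimension shifting makes the
corresponding syzygies Δ-filtered.

Graded extensions over A and extensions over A_0 are compared through short exact sequences 0 → K →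
P → V → 0 with P projective over A_0. Such a P is Δ-filtered, so the Q-Koszul condition gives
ext^i_A(P, ∇⟨j⟩) = 0 for 0 < i ≤ n + 1, i ≠ j, and dimension shifting still works although P is not
projective over A. In one direction, Ext^q(V, ∇) = 0 over A_0 implies ext^p_A(V, ∇⟨m⟩) = 0 when q ≤
p ≤ n + 1 and m + q ≤ p (`ext_inflate_of_ext`). In the other, ext^q_A(V, ∇) = 0 implies Ext^q(V, ∇)
= 0 over A_0 (`ext_of_ext_inflate`).

The vanishing for A_s is proved by strong induction on s (`ext_piece`). The sequences A_{≥t+1} →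
A_{≥t} → A_t, for t < s, carry ext^s(-, ∇⟨s⟩) = 0 from the free module A down to A_{≥s}: the
obstruction ext^{s+1}(A_t, ∇⟨s⟩) vanishes by the induction hypothesis and the first comparison. This
uses ext in degree s + 1, which is why (n + 1)-Q-Koszulity is needed for s ≤ n. Since A_{≥s+1} lies
above the degree of ∇⟨s⟩, the sequence at t = s yields ext^s(A_s, ∇⟨s⟩) = 0. Shifting back to degree
zero, the second comparison finishes (a). Part (b) is the first comparison applied to A_s. -/

/-! ### Vanishing of Ext from the long exact sequences. -/

section ExtVanishing

open Limits Abelian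

variable {C : Type u} [Category.{v} C] [Abelian C] [HasExt.{w} C]

theorem ext_subsingleton_middle {S : ShortComplex C} (hS : S.ShortExact) {Y : C} {n : ℕ}
    (h₁ : Subsingleton (Ext.{w} S.X₁ Y n)) (h₃ : Subsingleton (Ext.{w} S.X₃ Y n)) :
    Subsingleton (Ext.{w} S.X₂ Y n) := by
  refine subsingleton_of_forall_eq 0 fun x => ?_
  obtain ⟨y, rfl⟩ := Ext.contravariant_sequence_exact₂ hS Y x (Subsingleton.elim _ _)
  rw [Subsingleton.elim y 0, Ext.comp_zero]

theorem ext_subsingleton_right {S : ShortComplex C} (hS : S.ShortExact) {Y : C} {n : ℕ}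
    (h₁ : Subsingleton (Ext.{w} S.X₁ Y n)) (h₂ : Subsingleton (Ext.{w} S.X₂ Y (n + 1))) :
    Subsingleton (Ext.{w} S.X₃ Y (n + 1)) := by
  refine subsingleton_of_forall_eq 0 fun x => ?_
  obtain ⟨y, rfl⟩ := Ext.contravariant_sequence_exact₃ hS Y x (Subsingleton.elim _ _)
    (add_comm 1 n)
  rw [Subsingleton.elim y 0, Ext.comp_zero]

theorem ext_subsingleton_left {S : ShortComplex C} (hS : S.ShortExact) {Y : C} {n : ℕ}
    (h₂ : Subsingleton (Ext.{w} S.X₂ Y n)) (h₃ : Subsingleton (Ext.{w} S.X₃ Y (n + 1))) :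
    Subsingleton (Ext.{w} S.X₁ Y n) := by
  refine subsingleton_of_forall_eq 0 fun x => ?_
  obtain ⟨y, rfl⟩ := Ext.contravariant_sequence_exact₁ hS Y x (add_comm 1 n)
    (Subsingleton.elim _ _)
  rw [Subsingleton.elim y 0, Ext.comp_zero]

theorem ext_subsingleton_middle' {S : ShortComplex C} (hS : S.ShortExact) {X : C} {n : ℕ}
    (h₁ : Subsingleton (Ext.{w} X S.X₁ n)) (h₃ : Subsingleton (Ext.{w} X S.X₃ n)) :
    Subsingleton (Ext.{w} X S.X₂ n) := by
  refine subsingleton_of_forall_eq 0 fun x => ?_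
  obtain ⟨y, rfl⟩ := Ext.covariant_sequence_exact₂ X hS x (Subsingleton.elim _ _)
  rw [Subsingleton.elim y 0, Ext.zero_comp]

theorem ext_subsingleton_left' {S : ShortComplex C} (hS : S.ShortExact) {X : C} {n : ℕ}
    (h₃ : Subsingleton (Ext.{w} X S.X₃ n)) (h₂ : Subsingleton (Ext.{w} X S.X₂ (n + 1))) :
    Subsingleton (Ext.{w} X S.X₁ (n + 1)) := by
  refine subsingleton_of_forall_eq 0 fun x => ?_
  obtain ⟨y, rfl⟩ := Ext.covariant_sequence_exact₁ X hS x (Subsingleton.elim _ _) rfl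
  rw [Subsingleton.elim y 0, Ext.zero_comp]

theorem ext_subsingleton_of_iso_left {X X' Y : C} (e : X ≅ X') {n : ℕ}
    (h : Subsingleton (Ext.{w} X Y n)) : Subsingleton (Ext.{w} X' Y n) := by
  refine subsingleton_of_forall_eq 0 fun x => ?_
  have h1 : (Ext.mk₀ e.inv).comp ((Ext.mk₀ e.hom).comp x (zero_add n)) (zero_add n) = x := by
    rw [Ext.mk₀_comp_mk₀_assoc, e.inv_hom_id, Ext.mk₀_id_comp]
  rw [← h1, Subsingleton.elim ((Ext.mk₀ e.hom).comp x (zero_add n)) 0, Ext.comp_zero]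

theorem ext_subsingleton_of_iso_right {X Y Y' : C} (e : Y ≅ Y') {n : ℕ}
    (h : Subsingleton (Ext.{w} X Y n)) : Subsingleton (Ext.{w} X Y' n) := by
  refine subsingleton_of_forall_eq 0 fun x => ?_
  have h1 : (x.comp (Ext.mk₀ e.inv) (add_zero n)).comp (Ext.mk₀ e.hom) (add_zero n) = x := by
    rw [Ext.comp_assoc_of_second_deg_zero, Ext.mk₀_comp_mk₀, e.inv_hom_id, Ext.comp_mk₀_id]
  rw [← h1, Subsingleton.elim (x.comp (Ext.mk₀ e.inv) (add_zero n)) 0, Ext.zero_comp]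

theorem ext_zero_subsingleton {X Y : C} (h : ∀ f : X ⟶ Y, f = 0) :
    Subsingleton (Ext.{w} X Y 0) := by
  refine subsingleton_of_forall_eq 0 fun x => ?_
  obtain ⟨f, rfl⟩ := Ext.addEquiv₀.symm.surjective x
  rw [h f, map_zero]

theorem ext_subsingleton_of_isZero {X Y : C} (h : IsZero X) (n : ℕ) :
    Subsingleton (Ext.{w} X Y n) := by
  refine subsingleton_of_forall_eq 0 fun x => ?_
  rw [← Ext.mk₀_id_comp x, h.eq_of_src (𝟙 X) 0, Ext.mk₀_zero, Ext.zero_comp]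

theorem ext_subsingleton_of_isZero' {X Y : C} (h : IsZero Y) (n : ℕ) :
    Subsingleton (Ext.{w} X Y n) := by
  refine subsingleton_of_forall_eq 0 fun x => ?_
  rw [← Ext.comp_mk₀_id x, h.eq_of_src (𝟙 Y) 0, Ext.mk₀_zero, Ext.comp_zero]

theorem exists_extension_of_ext_one {S : ShortComplex C} (hS : S.ShortExact) {Y : C}
    (h : Subsingleton (Ext.{w} S.X₃ Y 1)) (f : S.X₁ ⟶ Y) : ∃ g : S.X₂ ⟶ Y, S.f ≫ g = f := by
  obtain ⟨y, hy⟩ := Ext.contravariant_sequence_exact₁ hS Y (Ext.mk₀ f) (add_zero 1)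
    (Subsingleton.elim _ _)
  obtain ⟨g, rfl⟩ := Ext.addEquiv₀.symm.surjective y
  refine ⟨g, (Ext.mk₀_bijective _ _).1 ?_⟩
  rw [← hy, ← Ext.mk₀_comp_mk₀]
  rfl

theorem exists_lift_of_ext_one {S : ShortComplex C} (hS : S.ShortExact) {X : C}
    (h : Subsingleton (Ext.{w} X S.X₁ 1)) (f : X ⟶ S.X₃) : ∃ g : X ⟶ S.X₂, g ≫ S.g = f := by
  obtain ⟨y, hy⟩ := Ext.covariant_sequence_exact₃ X hS (Ext.mk₀ f) (zero_add 1)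
    (Subsingleton.elim _ _)
  obtain ⟨g, rfl⟩ := Ext.addEquiv₀.symm.surjective y
  refine ⟨g, (Ext.mk₀_bijective _ _).1 ?_⟩
  rw [← hy, ← Ext.mk₀_comp_mk₀]
  rfl

/-- Every class in Ext¹(X₃, Y) is the image of some X₁ → Y under the connecting map, and maps that
extend to X₂ go to zero. This turns Ext¹ vanishing into a statement about homomorphisms, which can
be moved between categories without a functor on Ext. -/
theorem ext_one_subsingleton_of_extension {S : ShortComplex C} (hS : S.ShortExact) {Y : C}
    (h₂ : Subsingleton (Ext.{w} S.X₂ Y 1)) (h : ∀ f : S.X₁ ⟶ Y, ∃ g : S.X₂ ⟶ Y, S.f ≫ g = f) :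
    Subsingleton (Ext.{w} S.X₃ Y 1) := by
  refine subsingleton_of_forall_eq 0 fun x => ?_
  obtain ⟨y, rfl⟩ := Ext.contravariant_sequence_exact₃ hS Y x (Subsingleton.elim _ _)
    (add_zero 1)
  obtain ⟨f, rfl⟩ := Ext.addEquiv₀.symm.surjective y
  obtain ⟨g, rfl⟩ := h f
  change hS.extClass.comp (Ext.mk₀ (S.f ≫ g)) _ = 0
  -- The extension class composed with `S.f` is zero.
  rw [← Ext.mk₀_comp_mk₀, hS.extClass_comp_assoc]

end ExtVanishing

/-! ### Finitely generated modules: exact sequences and filtrations. -/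

namespace FGModuleCat

open Limits Abelian

variable {R : Type u} [Ring R]

/-- A linear map, as a morphism of finitely generated modules. -/
abbrev homOfLin {X Y : FGModuleCat.{u} R} (f : X →ₗ[R] Y) : X ⟶ Y := FGModuleCat.ofHom f

/-- The linear map underlying a morphism of finitely generated modules. -/
abbrev linOfHom {X Y : FGModuleCat.{u} R} (f : X ⟶ Y) : X →ₗ[R] Y := f.hom.hom

/-- The complex attached to two composable linear maps with zero composition. -/
abbrev complexOfLin {X Y Z : FGModuleCat.{u} R} (f : X →ₗ[R] Y) (g : Y →ₗ[R] Z)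
    (h : Function.Exact f g) : ShortComplex (FGModuleCat.{u} R) :=
  ShortComplex.mk (homOfLin f) (homOfLin g)
    (hom_ext (LinearMap.ext fun x => h.apply_apply_eq_zero x))

theorem mono_homOfLin {X Y : FGModuleCat.{u} R} {f : X →ₗ[R] Y} (hf : Function.Injective f) :
    Mono (homOfLin f) where
  right_cancellation g g' e := by
    apply hom_ext
    apply LinearMap.ext
    intro x
    exact hf (LinearMap.congr_fun (congrArg linOfHom e) x)

theorem epi_homOfLin {X Y : FGModuleCat.{u} R} {f : X →ₗ[R] Y} (hf : Function.Surjective f) :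
    Epi (homOfLin f) where
  left_cancellation g g' e := by
    apply hom_ext
    apply LinearMap.ext
    intro x
    obtain ⟨x, rfl⟩ := hf x
    exact LinearMap.congr_fun (congrArg linOfHom e) x

theorem projective_of_module (P : FGModuleCat.{u} R) [Module.Projective R P]
    [IsNoetherianRing R] : Projective P where
  factors {E X} f e he := by
    have hs : Function.Surjective (linOfHom e) := by
      have := (ModuleCat.epi_iff_surjective ((forget₂ (FGModuleCat.{u} R) (ModuleCat.{u} R)).map e)).1
        inferInstance
      exact this
    obtain ⟨h, hh⟩ := Module.projective_lifting_property (linOfHom e) (linOfHom f) hs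
    exact ⟨homOfLin h, hom_ext hh⟩

theorem shortExact_of_lin [IsNoetherianRing R] {X Y Z : FGModuleCat.{u} R} {f : X →ₗ[R] Y}
    {g : Y →ₗ[R] Z} (h : Function.Exact f g) (hf : Function.Injective f)
    (hg : Function.Surjective g) : (complexOfLin f g h).ShortExact := by
  have := mono_homOfLin hf
  have := epi_homOfLin hg
  refine ShortComplex.ShortExact.mk ?_
  rw [← ShortComplex.exact_map_iff_of_faithful _ (forget₂ (FGModuleCat.{u} R) (ModuleCat.{u} R)),
    ShortComplex.ShortExact.moduleCat_exact_iff_function_exact]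
  exact h

/-- A linear equivalence, as an isomorphism of finitely generated modules. -/
def isoOfLin {X Y : FGModuleCat.{u} R} (e : X ≃ₗ[R] Y) : X ≅ Y where
  hom := homOfLin e.toLinearMap
  inv := homOfLin e.symm.toLinearMap
  hom_inv_id := hom_ext (LinearMap.ext e.symm_apply_apply)
  inv_hom_id := hom_ext (LinearMap.ext e.apply_symm_apply)

theorem isZero_of_subsingleton [IsNoetherianRing R] (X : FGModuleCat.{u} R) [Subsingleton X] :
    IsZero X := by
  rw [IsZero.iff_id_eq_zero]
  exact hom_ext (LinearMap.ext fun x => Subsingleton.elim _ _)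

/-- A submodule of a finitely generated module. -/
abbrev ofSub [IsNoetherianRing R] {M : Type u} [AddCommGroup M] [Module R M] [Module.Finite R M]
    (N : Submodule R M) : FGModuleCat.{u} R := FGModuleCat.of R N

/-- A finitely generated module is a quotient of a finitely generated free module. -/
theorem exists_projective_cover [IsNoetherianRing R] (X : FGModuleCat.{u} R) :
    ∃ (P : FGModuleCat.{u} R) (g : P →ₗ[R] X),
      Module.Projective R P ∧ Function.Surjective g := by
  obtain ⟨n, g, hg⟩ := Module.Finite.exists_fin' R X
  exact ⟨FGModuleCat.of R (Fin n → R), g, inferInstanceAs (Module.Projective R (Fin n → R)), hg⟩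

theorem shortExact_ker [IsNoetherianRing R] {P X : FGModuleCat.{u} R} {p : P →ₗ[R] X} (hp : Function.Surjective p) :
    (complexOfLin (X := ofSub (LinearMap.ker p)) (LinearMap.ker p).subtype p
      (LinearMap.exact_subtype_ker_map p)).ShortExact :=
  shortExact_of_lin _ Subtype.val_injective hp

section HasFiltration

variable {Λ : Type w} {D : Λ → FGModuleCat.{u} R} {T : Set Λ}

theorem hasFiltration_of_subsingleton (M : Type u) [AddCommGroup M] [Module R M]
    [Subsingleton M] : HasFiltration D T M :=
  ⟨0, fun _ => ⊥, rfl, Subsingleton.elim _ _, fun i hi => absurd hi (Nat.not_lt_zero i)⟩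

theorem hasFiltration_extend {M : Type u} [AddCommGroup M] [Module R M] {ν : Λ} (hν : ν ∈ T)
    (g : M →ₗ[R] D ν) (hg : Function.Surjective g) (h : HasFiltration D T (LinearMap.ker g)) :
    HasFiltration D T M := by
  obtain ⟨n, F, h0, hn, hF⟩ := h
  let ι := (LinearMap.ker g).subtype
  have hι : Function.Injective ι := Subtype.val_injective
  -- The filtration of the kernel, pushed into `M`, with one more step whose section is the image of
  -- `g`.
  let G : ℕ → Submodule R M := fun i => if i ≤ n then (F i).map ι else ⊤
  have hG : ∀ i, i ≤ n → G i = (F i).map ι := fun i hi => if_pos hi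
  have hG' : G (n + 1) = ⊤ := if_neg (Nat.not_succ_le_self n)
  refine ⟨n + 1, G, ?_, hG', ?_⟩
  · rw [hG 0 (Nat.zero_le n), h0, Submodule.map_bot]
  · intro i hi
    rcases Nat.lt_succ_iff_lt_or_eq.1 hi with hi | rfl
    · obtain ⟨hle, ν, hν, ⟨e⟩⟩ := hF i hi
      rw [hG i hi.le, hG (i + 1) hi]
      refine ⟨Submodule.map_mono hle, ν, hν, ⟨?_⟩⟩
      let E : F (i + 1) ≃ₗ[R] (F (i + 1)).map ι := Submodule.equivMapOfInjective ι hι _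
      refine (Submodule.Quotient.equiv _ _ E ?_).symm.trans e
      ext ⟨x, hx⟩
      rw [Submodule.mem_map]
      constructor
      · rintro ⟨y, hy, hyx⟩
        exact ⟨y.1, hy, congrArg Subtype.val hyx⟩
      · rintro ⟨y, hy, hyx⟩
        exact ⟨⟨y, hle hy⟩, hy, Subtype.ext hyx⟩
    · have h1 : (Submodule.map ι ⊤) = LinearMap.ker g := by simp [ι]
      rw [hG i le_rfl, hG', hn, h1]
      refine ⟨le_top, ν, hν, ⟨?_⟩⟩
      let E : (⊤ : Submodule R M) ≃ₗ[R] M := Submodule.topEquiv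
      refine (Submodule.Quotient.equiv _ (LinearMap.ker g) E ?_).trans
        (LinearMap.quotKerEquivOfSurjective g hg)
      ext x
      rw [Submodule.mem_map]
      constructor
      · rintro ⟨y, hy, rfl⟩
        exact hy
      · intro hx
        exact ⟨⟨x, trivial⟩, hx, rfl⟩

/-- Vanishing of Ext into a fixed module passes through extensions, so this induction propagates it
from the sections to a filtered module, both over A_0 and after inflation to A. -/
theorem HasFiltration.induction [IsNoetherianRing R] {P : FGModuleCat.{u} R → Prop}
    (hzero : ∀ X : FGModuleCat.{u} R, Subsingleton X → P X)
    (hiso : ∀ X Y : FGModuleCat.{u} R, Nonempty (X ≃ₗ[R] Y) → P X → P Y)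
    (hext : ∀ (X Y : FGModuleCat.{u} R) (ν : Λ) (f : X →ₗ[R] Y) (g : Y →ₗ[R] D ν),
      ν ∈ T → Function.Injective f → Function.Surjective g → Function.Exact f g → P X → P Y)
    (M : FGModuleCat.{u} R) (h : HasFiltration D T M) : P M := by
  obtain ⟨n, F, h0, hn, hF⟩ := h
  have key : ∀ i, i ≤ n → P (ofSub (F i)) := by
    intro i
    induction i with
    | zero =>
      intro _
      refine hzero _ ?_
      change Subsingleton (F 0)
      rw [h0]
      infer_instance
    | succ i ih =>
      intro hi
      obtain ⟨hle, ν, hν, ⟨e⟩⟩ := hF i hi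
      refine hext (ofSub (F i)) _ ν (Submodule.inclusion hle)
        (e.toLinearMap ∘ₗ ((F i).submoduleOf (F (i + 1))).mkQ) hν
        (Submodule.inclusion_injective hle)
        (e.surjective.comp (Submodule.mkQ_surjective _)) ?_ (ih (Nat.le_of_succ_le hi))
      intro x
      change e (Submodule.Quotient.mk x) = 0 ↔ _
      rw [LinearEquiv.map_eq_zero_iff, Submodule.Quotient.mk_eq_zero]
      constructor
      · intro hx
        exact ⟨⟨x.1, hx⟩, rfl⟩
      · rintro ⟨y, rfl⟩
        exact y.2
  refine hiso (ofSub (F n)) _ ⟨?_⟩ (key n le_rfl)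
  exact (LinearEquiv.ofEq _ _ hn).trans Submodule.topEquiv

end HasFiltration

end FGModuleCat

/-! ### Composition factors as quotients of submodules. -/

section CompositionFactors

variable {R : Type u} [Ring R]

theorem isCompositionFactor_of_surjective {S M : Type u} [AddCommGroup S] [Module R S]
    [AddCommGroup M] [Module R M] (N : Submodule R M) (φ : N →ₗ[R] S)
    (hφ : Function.Surjective φ) : IsCompositionFactor (R := R) S M := by
  refine ⟨(LinearMap.ker φ).map N.subtype, N, Submodule.map_subtype_le _ _, ⟨?_⟩⟩
  have h : ((LinearMap.ker φ).map N.subtype).submoduleOf N = LinearMap.ker φ :=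
    Submodule.comap_map_eq_of_injective Subtype.val_injective _
  rw [h]
  exact LinearMap.quotKerEquivOfSurjective φ hφ

theorem IsCompositionFactor.exists_surjective {S M : Type u} [AddCommGroup S] [Module R S]
    [AddCommGroup M] [Module R M] (h : IsCompositionFactor (R := R) S M) :
    ∃ (N : Submodule R M) (φ : N →ₗ[R] S), Function.Surjective φ := by
  obtain ⟨N₁, N₂, -, ⟨e⟩⟩ := h
  exact ⟨N₂, e.toLinearMap ∘ₗ (N₁.submoduleOf N₂).mkQ,
    e.surjective.comp (Submodule.mkQ_surjective _)⟩

theorem IsCompositionFactor.of_injective {S M M' : Type u} [AddCommGroup S] [Module R S]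
    [AddCommGroup M] [Module R M] [AddCommGroup M'] [Module R M'] (f : M →ₗ[R] M')
    (hf : Function.Injective f) (h : IsCompositionFactor (R := R) S M) :
    IsCompositionFactor (R := R) S M' := by
  obtain ⟨N, φ, hφ⟩ := h.exists_surjective
  exact isCompositionFactor_of_surjective (N.map f)
    (φ ∘ₗ (Submodule.equivMapOfInjective f hf N).symm.toLinearMap)
    (hφ.comp (Submodule.equivMapOfInjective f hf N).symm.surjective)

theorem IsCompositionFactor.of_surjective {S M M' : Type u} [AddCommGroup S] [Module R S]
    [AddCommGroup M] [Module R M] [AddCommGroup M'] [Module R M'] (g : M →ₗ[R] M')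
    (hg : Function.Surjective g) (h : IsCompositionFactor (R := R) S M') :
    IsCompositionFactor (R := R) S M := by
  obtain ⟨N, φ, hφ⟩ := h.exists_surjective
  refine isCompositionFactor_of_surjective (N.comap g)
    (φ ∘ₗ g.restrict (p := N.comap g) (q := N) fun x hx => hx) (hφ.comp ?_)
  rintro ⟨y, hy⟩
  obtain ⟨x, rfl⟩ := hg y
  exact ⟨⟨x, hy⟩, rfl⟩

end CompositionFactors

/-! ### Heads and socles over a quasi-hereditary algebra. -/

namespace IsQuasiHereditary

open FGModuleCat Abelian

variable {R : Type u} [Ring R] {Λ : Type w} [PartialOrder Λ] {L Δ nab : Λ → FGModuleCat.{u} R}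

theorem exists_surjective_simple (hQ : IsQuasiHereditary L Δ nab) (M : Type u) [AddCommGroup M]
    [Module R M] [Module.Finite R M] [Nontrivial M] :
    ∃ (ν : Λ) (g : M →ₗ[R] L ν), Function.Surjective g := by
  obtain h | ⟨N, hN, -⟩ := eq_top_or_exists_le_coatom (⊥ : Submodule R M)
  · exact absurd h bot_ne_top
  · obtain ⟨ν, ⟨e⟩⟩ := hQ.exhaustive (FGModuleCat.of R (M ⧸ N)) (isSimpleModule_iff_isCoatom.2 hN)
    exact ⟨ν, e.toLinearMap ∘ₗ N.mkQ, e.surjective.comp N.mkQ_surjective⟩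

theorem ne_zero_of_surjective (hQ : IsQuasiHereditary L Δ nab) {M : Type u} [AddCommGroup M]
    [Module R M] {ν : Λ} {f : M →ₗ[R] L ν} (hf : Function.Surjective f) : f ≠ 0 := by
  rintro rfl
  have := hQ.simple ν
  have := IsSimpleModule.nontrivial R (L ν)
  obtain ⟨x, hx⟩ := exists_ne (0 : L ν)
  obtain ⟨y, rfl⟩ := hf x
  exact hx rfl

/-- Both kernels are maximal submodules, so the inclusion is an equality and the two simple
quotients agree. -/
theorem eq_of_ker_eq (hQ : IsQuasiHereditary L Δ nab) {M : Type u} [AddCommGroup M]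
    [Module R M] {μ ν : Λ} {f : M →ₗ[R] L μ} {g : M →ₗ[R] L ν} (hf : f ≠ 0) (hg : g ≠ 0)
    (h : LinearMap.ker f ≤ LinearMap.ker g) : μ = ν := by
  have := hQ.simple μ
  have := hQ.simple ν
  have hf' := LinearMap.surjective_of_ne_zero hf
  have hg' := LinearMap.surjective_of_ne_zero hg
  have hcf := LinearMap.isCoatom_ker_of_surjective hf'
  have hcg := LinearMap.isCoatom_ker_of_surjective hg'
  have h' : LinearMap.ker f = LinearMap.ker g := (hcf.le_iff_eq hcg.1).1 h |>.symm
  exact hQ.eq_of_equiv μ ν ⟨(LinearMap.quotKerEquivOfSurjective f hf').symm.trans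
    ((Submodule.quotEquivOfEq _ _ h').trans (LinearMap.quotKerEquivOfSurjective g hg'))⟩

/-- A module of finite length has only finitely many irreducible quotients. -/
theorem finite_heads (hQ : IsQuasiHereditary L Δ nab) [IsNoetherianRing R] [IsArtinianRing R]
    (M : Type u) [AddCommGroup M] [Module R M] [Module.Finite R M] :
    {μ | ∃ g : M →ₗ[R] L μ, g ≠ 0}.Finite := by
  induction h : Module.length R M using WellFoundedLT.induction generalizing M with
  | ind l ih =>
    subst h
    rcases subsingleton_or_nontrivial M with hM | hM
    · convert Set.finite_empty
      refine Set.eq_empty_of_forall_notMem fun μ => ?_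
      rintro ⟨g, hg⟩
      exact hg (Subsingleton.elim _ _)
    · obtain ⟨ν, g₀, hg₀⟩ := hQ.exists_surjective_simple M
      have := hQ.simple ν
      have hne : g₀ ≠ 0 := hQ.ne_zero_of_surjective hg₀
      have hlt : Module.length R (LinearMap.ker g₀) < Module.length R M :=
        Submodule.length_lt fun h => hne (LinearMap.ker_eq_top.1 h)
      refine ((ih _ hlt (LinearMap.ker g₀) rfl).union (Set.finite_singleton ν)).subset ?_
      rintro μ ⟨g, hg⟩
      -- Either `g` factors through the chosen simple quotient, forcing μ = ν, or it restricts to a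
      -- nonzero map on the shorter module ker `g₀`.
      by_cases hz : g ∘ₗ (LinearMap.ker g₀).subtype = 0
      · right
        refine (hQ.eq_of_ker_eq hne hg fun x hx => ?_).symm
        exact LinearMap.congr_fun hz ⟨x, hx⟩
      · exact Or.inl ⟨_, hz⟩

/-- Λ is not assumed finite; a minimal weight exists because only finitely many weights occur in the
head of `M`. -/
theorem exists_minimal_head (hQ : IsQuasiHereditary L Δ nab) [IsNoetherianRing R]
    [IsArtinianRing R] (M : Type u) [AddCommGroup M] [Module R M] [Module.Finite R M]
    [Nontrivial M] :
    ∃ (μ : Λ) (g : M →ₗ[R] L μ), Function.Surjective g ∧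
      ∀ ν < μ, ∀ f : M →ₗ[R] L ν, f = 0 := by
  obtain ⟨ν, g₀, hg₀⟩ := hQ.exists_surjective_simple M
  have hs := fun μ => hQ.simple μ
  have hne : g₀ ≠ 0 := hQ.ne_zero_of_surjective hg₀
  obtain ⟨μ, hμ⟩ := (hQ.finite_heads M).exists_minimal ⟨ν, g₀, hne⟩
  obtain ⟨g, hg⟩ := hμ.prop
  refine ⟨μ, g, LinearMap.surjective_of_ne_zero hg, fun ν hν f => ?_⟩
  by_contra hf
  exact hμ.not_lt ⟨f, hf⟩ hν

/-- A map vanishes if no composition factor of the target is a quotient of the source. -/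
theorem eq_zero_of_factors (hQ : IsQuasiHereditary L Δ nab) {M X : Type u} [AddCommGroup M]
    [Module R M] [Module.Finite R M] [AddCommGroup X] [Module R X]
    (h : ∀ ν, IsCompositionFactor (R := R) (L ν) X → ∀ f : M →ₗ[R] L ν, f = 0)
    (f : M →ₗ[R] X) : f = 0 := by
  rcases subsingleton_or_nontrivial (LinearMap.range f) with hM | hM
  · rw [← LinearMap.range_eq_bot]
    exact Submodule.subsingleton_iff_eq_bot.1 hM
  · exfalso
    obtain ⟨ν, g, hg⟩ := hQ.exists_surjective_simple (LinearMap.range f)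
    exact hQ.ne_zero_of_surjective (f := g ∘ₗ f.rangeRestrict)
      (hg.comp f.surjective_rangeRestrict)
      (h ν (isCompositionFactor_of_surjective _ g hg) (g ∘ₗ f.rangeRestrict))

/-- The image of L(μ) in its injective hull has L(μ) as its only composition factor, so it lies in
the largest submodule with factors ≤ μ, which is ∇(μ). -/
theorem exists_socle (hQ : IsQuasiHereditary L Δ nab) (μ : Λ) :
    ∃ f : L μ →ₗ[R] nab μ, Function.Injective f := by
  obtain ⟨I, i, j, hi, hj, -, hmax⟩ := hQ.costandard μ
  have hs := hQ.simple μ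
  have hle : LinearMap.range i ≤ LinearMap.range j := by
    refine hmax _ fun ν hν => ?_
    obtain ⟨N, φ, hφ⟩ := hν.exists_surjective
    have hsν := hQ.simple ν
    let e := LinearEquiv.ofInjective i hi.injective
    have hs' : IsSimpleModule R (LinearMap.range i) := IsSimpleModule.congr e.symm
    rcases eq_bot_or_eq_top N with rfl | rfl
    · exact absurd (Subsingleton.elim φ 0) (hQ.ne_zero_of_surjective hφ)
    · refine (hQ.eq_of_equiv ν μ ⟨?_⟩).le
      have hφ' : Function.Surjective (φ ∘ₗ Submodule.topEquiv.symm.toLinearMap ∘ₗ e.toLinearMap) :=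
        hφ.comp (Submodule.topEquiv.symm.surjective.comp e.surjective)
      refine (LinearEquiv.ofBijective _
        (LinearMap.bijective_of_ne_zero (f := φ ∘ₗ Submodule.topEquiv.symm.toLinearMap ∘ₗ
          e.toLinearMap) ?_)).symm
      exact hQ.ne_zero_of_surjective hφ'
  let e := LinearEquiv.ofInjective j hj
  refine ⟨e.symm.toLinearMap ∘ₗ i.codRestrict _ fun x => hle ⟨x, rfl⟩, ?_⟩
  refine e.symm.injective.comp fun x y hxy => hi.injective (congrArg Subtype.val hxy)

/-- Superfluity of the kernel of Δ(μ) → L(μ) is inherited from the projective cover P(μ): a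
submodule supplementing it pulls back to one supplementing ker `p`. -/
theorem exists_head (hQ : IsQuasiHereditary L Δ nab) (μ : Λ) :
    ∃ f : Δ μ →ₗ[R] L μ, Function.Surjective f ∧
      (∀ ν, IsCompositionFactor (R := R) (L ν) (LinearMap.ker f) → ν < μ) ∧
      ∀ N : Submodule R (Δ μ), N ⊔ LinearMap.ker f = ⊤ → N = ⊤ := by
  obtain ⟨f, hf, hν⟩ := hQ.head μ
  refine ⟨f, hf, hν, fun N hN => ?_⟩
  obtain ⟨P, p, q, hp, hq, -, -⟩ := hQ.standard μ
  have hs := hQ.simple μ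
  have hc := LinearMap.isCoatom_ker_of_surjective (f := f ∘ₗ q) (hf.comp hq)
  have hcp := LinearMap.isCoatom_ker_of_surjective hp.surjective
  -- A maximal submodule not containing ker `p` would together with it span P, contradicting
  -- superfluity. Both kernels being maximal, they coincide.
  have hle : LinearMap.ker p ≤ LinearMap.ker (f ∘ₗ q) := by
    by_contra hle
    exact hc.1 (hp.superfluous _ (hc.2 _ (left_lt_sup.2 hle)))
  have heq := (hcp.le_iff_eq hc.1).1 hle
  have h1 : N.comap q ⊔ LinearMap.ker p = ⊤ := by
    rw [← heq, LinearMap.ker_comp, eq_top_iff]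
    intro x _
    obtain ⟨y, hy, z, hz, hyz⟩ := Submodule.mem_sup.1 (hN ▸ trivial : q x ∈ N ⊔ LinearMap.ker f)
    obtain ⟨y', rfl⟩ := hq y
    refine Submodule.mem_sup.2 ⟨y', hy, x - y', ?_, add_sub_cancel _ _⟩
    change f (q (x - y')) = 0
    rw [map_sub, ← hyz, add_sub_cancel_left]
    exact hz
  have h2 := hp.superfluous _ h1
  rw [eq_top_iff]
  intro x _
  obtain ⟨y, rfl⟩ := hq x
  exact (h2 ▸ trivial : y ∈ N.comap q)

end IsQuasiHereditary

/-! ### Dimension shifting over a Noetherian ring. -/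

namespace FGModuleCat

open Abelian

variable {R : Type u} [Ring R] [IsNoetherianRing R] [HasExt.{u + 1} (FGModuleCat.{u} R)]

theorem ext_subsingleton_of_projective (P Y : FGModuleCat.{u} R) (hP : Module.Projective R P)
    {n : ℕ} (hn : 0 < n) : Subsingleton (Ext.{u + 1} P Y n) := by
  have := projective_of_module P
  obtain ⟨n, rfl⟩ := Nat.exists_eq_succ_of_ne_zero hn.ne'
  exact Ext.subsingleton_of_projective P Y n

theorem hasFiltration_ext_subsingleton {Λ : Type w} {D : Λ → FGModuleCat.{u} R} {T : Set Λ}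
    {X Y : FGModuleCat.{u} R} {n : ℕ} (hX : HasFiltration D T X)
    (h : ∀ ν ∈ T, Subsingleton (Ext.{u + 1} (D ν) Y n)) : Subsingleton (Ext.{u + 1} X Y n) := by
  refine HasFiltration.induction (P := fun X => Subsingleton (Ext.{u + 1} X Y n)) ?_ ?_ ?_ X hX
  · intro X _
    exact ext_subsingleton_of_isZero (isZero_of_subsingleton X) n
  · rintro X X' ⟨e⟩ hX
    exact ext_subsingleton_of_iso_left (isoOfLin e) hX
  · intro X X' ν f g hν hf hg hfg hX
    exact ext_subsingleton_middle (shortExact_of_lin hfg hf hg) hX (h ν hν)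

/-- Dimension shifting along a syzygy. -/
theorem ext_syzygy_subsingleton {V W Y : FGModuleCat.{u} R} {m : ℕ} (h : IsSyzygy V m W)
    {n : ℕ} (hn : 0 < n) (hV : Subsingleton (Ext.{u + 1} V Y (m + n))) :
    Subsingleton (Ext.{u + 1} W Y n) := by
  induction h generalizing n with
  | zero W e =>
    rw [zero_add] at hV
    exact ext_subsingleton_of_iso_left (isoOfLin e) hV
  | succ m U P W hU p hp e ih =>
    have h1 := ih (Nat.succ_pos n) (by rwa [Nat.succ_eq_add_one, ← add_assoc, add_right_comm])
    exact ext_subsingleton_of_iso_left (isoOfLin (X := ofSub (LinearMap.ker p)) e)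
      (ext_subsingleton_left (shortExact_ker hp.surjective)
        (ext_subsingleton_of_projective P Y hp.projective hn) h1)

end FGModuleCat

/-! ### The Ext criterion for Δ-filtrations. -/

namespace IsQuasiHereditary

open FGModuleCat Abelian

variable {R : Type u} [Ring R] [IsNoetherianRing R] [HasExt.{u + 1} (FGModuleCat.{u} R)]
  {Λ : Type w} [PartialOrder Λ] {L Δ nab : Λ → FGModuleCat.{u} R}

/-- Ext^{n+1}(Δ(μ), ∇) is a quotient of Ext^n(ker(P(μ) → Δ(μ)), ∇), and that kernel is Δ-filtered.
-/
theorem ext_standard_costandard (hQ : IsQuasiHereditary L Δ nab)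
    (h1 : ∀ μ ν, Subsingleton (Ext.{u + 1} (Δ μ) (nab ν) 1)) {n : ℕ} (hn : 0 < n) (μ ν : Λ) :
    Subsingleton (Ext.{u + 1} (Δ μ) (nab ν) n) := by
  induction n, hn using Nat.le_induction generalizing μ with
  | base => exact h1 μ ν
  | succ n hn ih =>
    obtain ⟨P, p, q, hp, hq, hF⟩ := hQ.filtration μ
    exact ext_subsingleton_right (shortExact_ker hq)
      (hasFiltration_ext_subsingleton (X := ofSub (LinearMap.ker q)) hF fun ν _ => ih ν)
      (ext_subsingleton_of_projective P _ hp.projective (Nat.succ_pos n))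

/-- `Ext¹(M, L(ν)) = 0` if `Ext¹(M, ∇(ν)) = 0` and no `L(κ)` with `κ ≤ ν` is a quotient of `M`. -/
theorem ext_one_simple (hQ : IsQuasiHereditary L Δ nab) {M : FGModuleCat.{u} R} {ν : Λ}
    (h : Subsingleton (Ext.{u + 1} M (nab ν) 1)) (h0 : ∀ κ ≤ ν, ∀ f : M →ₗ[R] L κ, f = 0) :
    Subsingleton (Ext.{u + 1} M (L ν) 1) := by
  obtain ⟨f, hf⟩ := hQ.exists_socle ν
  have hS := shortExact_of_lin (Z := FGModuleCat.of R (nab ν ⧸ LinearMap.range f)) (f := f)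
    (g := (LinearMap.range f).mkQ) (LinearMap.exact_map_mkQ_range f) hf
    (Submodule.mkQ_surjective _)
  -- Ext¹(M, L(ν)) sits between Hom(M, ∇(ν)/L(ν)) and Ext¹(M, ∇(ν)); the former is zero because all
  -- factors of ∇(ν) have weight ≤ ν.
  refine ext_subsingleton_left' hS (ext_zero_subsingleton fun g => ?_) h
  obtain ⟨-, -, -, -, -, hle, -⟩ := hQ.costandard ν
  refine hom_ext (hQ.eq_zero_of_factors (fun κ hκ => h0 κ (hle κ ?_)) (linOfHom g))
  exact hκ.of_surjective _ (Submodule.mkQ_surjective _)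

theorem ext_one_of_factors [IsArtinianRing R] (hQ : IsQuasiHereditary L Δ nab)
    {M : FGModuleCat.{u} R} (X : FGModuleCat.{u} R)
    (h : ∀ ν, IsCompositionFactor (R := R) (L ν) X → Subsingleton (Ext.{u + 1} M (L ν) 1)) :
    Subsingleton (Ext.{u + 1} M X 1) := by
  induction hl : Module.length R X using WellFoundedLT.induction generalizing X with
  | ind l ih =>
    subst hl
    rcases subsingleton_or_nontrivial X with hX | hX
    · exact ext_subsingleton_of_isZero' (isZero_of_subsingleton X) 1
    · obtain ⟨ν, g, hg⟩ := hQ.exists_surjective_simple X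
      refine ext_subsingleton_middle' (shortExact_ker hg)
        (ih _ (Submodule.length_lt fun h => hQ.ne_zero_of_surjective hg
          (LinearMap.ker_eq_top.1 h)) (ofSub (LinearMap.ker g)) (fun κ hκ => ?_) rfl) (h ν ?_)
      · exact h κ (hκ.of_injective (LinearMap.ker g).subtype Subtype.val_injective)
      · exact isCompositionFactor_of_surjective ⊤ (g ∘ₗ Submodule.topEquiv.toLinearMap)
          (hg.comp Submodule.topEquiv.surjective)

/-- A module with no first extensions by costandard modules surjects onto a standard module. -/
theorem exists_surjective_standard [IsArtinianRing R] (hQ : IsQuasiHereditary L Δ nab)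
    (M : FGModuleCat.{u} R) [Nontrivial M]
    (h : ∀ ν, Subsingleton (Ext.{u + 1} M (nab ν) 1)) :
    ∃ (μ : Λ) (g : M →ₗ[R] Δ μ), Function.Surjective g := by
  obtain ⟨μ, g, hg, hmin⟩ := hQ.exists_minimal_head M
  obtain ⟨f, hf, hν, hsup⟩ := hQ.exists_head μ
  -- The obstruction to lifting M → L(μ) to Δ(μ) lies in Ext¹(M, ker `f`). The factors of ker `f`
  -- have weight < μ, so minimality of μ in the head of M makes it vanish.
  obtain ⟨l, hl⟩ := exists_lift_of_ext_one (shortExact_ker hf) (X := M)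
    (hQ.ext_one_of_factors (ofSub (LinearMap.ker f)) fun ν hκ =>
      hQ.ext_one_simple (h ν) fun κ hκν => hmin κ (hκν.trans_lt (hν ν hκ))) (homOfLin g)
  -- The lift is onto because its range and the superfluous kernel of `f` span Δ(μ).
  refine ⟨μ, linOfHom l, LinearMap.range_eq_top.1 (hsup _ (eq_top_iff.2 fun x _ => ?_))⟩
  obtain ⟨y, hy⟩ := hg (f x)
  have hl' : f (linOfHom l y) = g y := LinearMap.congr_fun (congrArg linOfHom hl) y
  refine Submodule.mem_sup.2 ⟨linOfHom l y, ⟨y, rfl⟩, x - linOfHom l y, ?_, add_sub_cancel _ _⟩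
  rw [LinearMap.mem_ker, map_sub, hl', hy, sub_self]

/-- The cohomological criterion for the existence of a filtration by standard modules. -/
theorem hasFiltration_of_ext_one [IsArtinianRing R] (hQ : IsQuasiHereditary L Δ nab)
    (h1 : ∀ μ ν, Subsingleton (Ext.{u + 1} (Δ μ) (nab ν) 1)) (M : FGModuleCat.{u} R)
    (h : ∀ ν, Subsingleton (Ext.{u + 1} M (nab ν) 1)) : HasFiltration Δ Set.univ M := by
  induction hl : Module.length R M using WellFoundedLT.induction generalizing M with
  | ind l ih =>
    subst hl
    rcases subsingleton_or_nontrivial M with hM | hM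
    · exact hasFiltration_of_subsingleton M
    · obtain ⟨μ, g, hg⟩ := hQ.exists_surjective_standard M h
      refine hasFiltration_extend (Set.mem_univ μ) g hg
        (ih _ (Submodule.length_lt fun h => ?_) (ofSub (LinearMap.ker g)) (fun ν => ?_) rfl)
      · obtain ⟨f, hf, -⟩ := hQ.head μ
        have h0 : f ∘ₗ g = 0 := by rw [LinearMap.ker_eq_top.1 h, LinearMap.comp_zero]
        exact hQ.ne_zero_of_surjective (f := f ∘ₗ g) (hf.comp hg) h0
      -- The kernel inherits the Ext¹ hypothesis from M because Ext²(Δ, ∇) = 0.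
      · exact ext_subsingleton_left (shortExact_ker hg) (h ν)
          (hQ.ext_standard_costandard h1 two_pos μ ν)

/-- In degree 1 the hypothesis makes M Δ-filtered, which kills Ext²; higher degrees reduce to this
one by passing to a syzygy. -/
theorem ext_succ_costandard [IsArtinianRing R] (hQ : IsQuasiHereditary L Δ nab)
    (h1 : ∀ μ ν, Subsingleton (Ext.{u + 1} (Δ μ) (nab ν) 1)) {n : ℕ} (hn : 0 < n)
    (M : FGModuleCat.{u} R) (h : ∀ ν, Subsingleton (Ext.{u + 1} M (nab ν) n)) (ν : Λ) :
    Subsingleton (Ext.{u + 1} M (nab ν) (n + 1)) := by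
  induction n, hn using Nat.le_induction generalizing M ν with
  | base =>
    exact hasFiltration_ext_subsingleton (hQ.hasFiltration_of_ext_one h1 M h) fun μ _ =>
      hQ.ext_standard_costandard h1 two_pos μ ν
  | succ n hn ih =>
    obtain ⟨P, p, hP, hp⟩ := exists_projective_cover M
    refine ext_subsingleton_right (shortExact_ker hp) (ih _ (fun κ => ?_) ν)
      (ext_subsingleton_of_projective P _ hP (Nat.succ_pos _))
    exact ext_subsingleton_left (shortExact_ker hp)
      (ext_subsingleton_of_projective P _ hP hn) (h κ)

theorem ext_costandard_of_le [IsArtinianRing R] (hQ : IsQuasiHereditary L Δ nab)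
    (h1 : ∀ μ ν, Subsingleton (Ext.{u + 1} (Δ μ) (nab ν) 1)) {m n : ℕ} (hm : 0 < m)
    (hmn : m ≤ n) (M : FGModuleCat.{u} R) (h : ∀ ν, Subsingleton (Ext.{u + 1} M (nab ν) m))
    (ν : Λ) : Subsingleton (Ext.{u + 1} M (nab ν) n) := by
  induction n, hmn using Nat.le_induction generalizing ν with
  | base => exact h ν
  | succ n hn ih => exact hQ.ext_succ_costandard h1 (hm.trans_le hn) M ih ν

theorem hasFiltration_syzygy [IsArtinianRing R] (hQ : IsQuasiHereditary L Δ nab)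
    (h1 : ∀ μ ν, Subsingleton (Ext.{u + 1} (Δ μ) (nab ν) 1)) {m n : ℕ} (hm : 0 < m)
    (hmn : m - 1 ≤ n) {V W : FGModuleCat.{u} R}
    (h : ∀ ν, Subsingleton (Ext.{u + 1} V (nab ν) m)) (hW : IsSyzygy V n W) :
    HasFiltration Δ Set.univ W :=
  -- Ext¹ of the `n`th syzygy vanishes once Ext^{n+1}(V, ∇) does, and `m - 1 ≤ n` says exactly `m ≤
  -- n + 1`.
  hQ.hasFiltration_of_ext_one h1 W fun ν => ext_syzygy_subsingleton hW one_pos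
    (hQ.ext_costandard_of_le h1 hm (by omega) V h ν)

end IsQuasiHereditary

/-! ### Graded modules: shifts and graded free covers. -/

namespace GrMod

open Limits Abelian

variable {k : Type v} {A : Type u} [Field k] [Ring A] [Algebra k A] {𝒜 : ℕ → Submodule k A}

/-! #### Exactness, shifts and generators -/

/-- The complex attached to two morphisms that are exact as linear maps. -/
abbrev complexOfExact {M N P : GrMod 𝒜} (f : M ⟶ N) (g : N ⟶ P)
    (h : Function.Exact (Hom.lin f) (Hom.lin g)) : ShortComplex (GrMod 𝒜) :=
  ShortComplex.mk f g (Hom.ext' (LinearMap.ext fun x => h.apply_apply_eq_zero x))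

theorem shortExact_of_exact [IsNoetherianRing A] {M N P : GrMod 𝒜} {f : M ⟶ N} {g : N ⟶ P}
    (h : Function.Exact (Hom.lin f) (Hom.lin g)) (hf : Function.Injective (Hom.lin f))
    (hg : Function.Surjective (Hom.lin g)) : (complexOfExact f g h).ShortExact := by
  have := mono_of_injective f hf
  have := epi_of_surjective g hg
  -- An epimorphism is the cokernel of its kernel; a map killing the image of `f` kills that kernel.
  refine ShortComplex.ShortExact.mk (ShortComplex.exact_of_g_is_cokernel _ ?_)
  refine CokernelCofork.IsColimit.ofπ' _ _ fun q hq =>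
    CokernelCofork.IsColimit.desc' (normalEpi g).isColimit q ?_
  apply Hom.ext'
  apply LinearMap.ext
  rintro ⟨x, hx⟩
  obtain ⟨y, rfl⟩ := (h x).1 hx
  exact LinearMap.congr_fun (congrArg Hom.lin hq) y

theorem shortExact_ker [IsNoetherianRing A] {M N : GrMod 𝒜} {f : M ⟶ N}
    (hf : Function.Surjective (Hom.lin f)) :
    (complexOfExact (kerι f) f (LinearMap.exact_subtype_ker_map (Hom.lin f))).ShortExact :=
  shortExact_of_exact _ Subtype.val_injective hf

/-- An isomorphism of graded modules from a linear equivalence preserving degrees. -/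
def isoOfLin {M N : GrMod 𝒜} (e : M.carrier ≃ₗ[A] N.carrier)
    (h : ∀ i x, x ∈ M.deg i ↔ e x ∈ N.deg i) : M ≅ N where
  hom := Hom.mk e.toLinearMap fun i x hx => (h i x).1 hx
  inv := Hom.mk e.symm.toLinearMap fun i x hx => (h i _).2 (by
    change e (e.symm x) ∈ _
    rwa [e.apply_symm_apply])
  hom_inv_id := Hom.ext' (LinearMap.ext e.symm_apply_apply)
  inv_hom_id := Hom.ext' (LinearMap.ext e.apply_symm_apply)

/-- The shift of a morphism. -/
def Hom.shift {M N : GrMod 𝒜} (f : M ⟶ N) (r : ℤ) : M.shift r ⟶ N.shift r :=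
  Hom.mk (M := M.shift r) (N := N.shift r) (Hom.lin (M := M) (N := N) f) fun i x hx => Hom.mem f (i - r) x hx

/-- The morphism whose shift is a given morphism. -/
def Hom.unshift {M N : GrMod 𝒜} {r : ℤ} (f : M.shift r ⟶ N.shift r) : M ⟶ N :=
  Hom.mk (M := M) (N := N) (Hom.lin (M := M.shift r) (N := N.shift r) f) fun i x hx => by
    have h := Hom.mem f (i + r) x (by change x ∈ M.deg (i + r - r); rwa [add_sub_cancel_right])
    change _ ∈ N.deg (i + r - r) at h
    rwa [add_sub_cancel_right] at h

/-- Iterated shifts. -/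
def shiftShiftIso (M : GrMod 𝒜) (a b c : ℤ) (h : a + b = c) : (M.shift a).shift b ≅ M.shift c :=
  isoOfLin (M := (M.shift a).shift b) (N := M.shift c) (LinearEquiv.refl A M.carrier)
    fun i x => by
      change x ∈ M.deg (i - b - a) ↔ x ∈ M.deg (i - c)
      rw [show i - b - a = i - c by omega]

/-- The shift by zero. -/
def shiftZeroIso (M : GrMod 𝒜) : M.shift 0 ≅ M :=
  isoOfLin (M := M.shift 0) (N := M) (LinearEquiv.refl A M.carrier) fun i x => by
    change x ∈ M.deg (i - 0) ↔ x ∈ M.deg i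
    rw [sub_zero]

theorem proj_smul (M : GrMod 𝒜) {t : ℕ} {a : A} (ha : a ∈ 𝒜 t) (j : ℤ) (x : M.carrier) :
    M.proj j (a • x) = a • M.proj (j - t) x := by
  induction M.mem_iSup x using AddSubgroup.iSup_induction' with
  | hp i y hy =>
    have h := M.smul_mem t i a y ha hy
    by_cases hij : i = j - t
    · subst hij
      rw [M.proj_of_mem hy]
      exact M.proj_of_mem (by rwa [add_sub_cancel] at h)
    · rw [M.proj_of_mem_ne hy hij, smul_zero, M.proj_of_mem_ne h (by omega)]
  | h1 => simp
  | hadd a b _ _ ha hb => rw [smul_add, map_add, ha, hb, map_add, smul_add]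

/-- A linear map preserves degrees if it does so on a set of homogeneous generators. -/
theorem map_mem_of_generators [GradedAlgebra 𝒜] {M N : GrMod 𝒜}
    (f : M.carrier →ₗ[A] N.carrier) {ι : Type*} (b : ι → M.carrier) (d : ι → ℤ)
    (hb : ∀ i, b i ∈ M.deg (d i)) (hf : ∀ i, f (b i) ∈ N.deg (d i))
    (hspan : Submodule.span A (Set.range b) = ⊤) (j : ℤ) (x : M.carrier) (hx : x ∈ M.deg j) :
    f x ∈ N.deg j := by
  have key : ∀ x : M.carrier, ∀ j, f (M.proj j x) = N.proj j (f x) := by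
    intro x
    have hx : x ∈ Submodule.span A (Set.range b) := hspan ▸ trivial
    induction hx using Submodule.span_induction with
    | mem x h =>
      obtain ⟨i, rfl⟩ := h
      intro j
      by_cases hij : d i = j
      · subst hij
        rw [M.proj_of_mem (hb i), N.proj_of_mem (hf i)]
      · rw [M.proj_of_mem_ne (hb i) hij, N.proj_of_mem_ne (hf i) hij, map_zero]
    | zero => simp
    | add x y _ _ hx hy => intro j; rw [map_add, map_add, hx, hy, map_add, map_add]
    | smul a x _ hx =>
      intro j
      induction a using DirectSum.Decomposition.inductionOn 𝒜 with
      | zero => simp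
      | homogeneous a =>
        rw [M.proj_smul a.2, map_smul, map_smul, N.proj_smul a.2, hx]
      | add a b ha hb => rw [add_smul, map_add, map_add, ha, hb, map_add, map_add]
  rw [← M.proj_of_mem hx, key]
  exact N.proj_mem j _

/-! #### Graded free modules -/

/-- A graded module with a basis of homogeneous elements. -/
def IsGradedFree (P : GrMod 𝒜) : Prop :=
  ∃ (ι : Type) (b : Module.Basis ι A P.carrier) (d : ι → ℤ), ∀ i, b i ∈ P.deg (d i)

theorem IsGradedFree.shift {P : GrMod 𝒜} (h : IsGradedFree P) (r : ℤ) :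
    IsGradedFree (P.shift r) := by
  obtain ⟨ι, b, d, hb⟩ := h
  refine ⟨ι, b, fun i => d i + r, fun i => ?_⟩
  change b i ∈ P.deg (d i + r - r)
  rw [add_sub_cancel_right]
  exact hb i

theorem IsGradedFree.prod {P Q : GrMod 𝒜} (hP : IsGradedFree P) (hQ : IsGradedFree Q) :
    IsGradedFree (P.prod Q) := by
  obtain ⟨ι, b, d, hb⟩ := hP
  obtain ⟨ι', b', d', hb'⟩ := hQ
  refine ⟨ι ⊕ ι', b.prod b', Sum.elim d d', ?_⟩
  rintro (i | i)
  · have h : b.prod b' (Sum.inl i) = (b i, 0) := by simp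
    exact h ▸ (⟨hb i, zero_mem _⟩ : _ ∈ P.deg (d i) ∧ _ ∈ Q.deg (d i))
  · have h : b.prod b' (Sum.inr i) = (0, b' i) := by simp
    exact h ▸ (⟨zero_mem _, hb' i⟩ : _ ∈ P.deg (d' i) ∧ _ ∈ Q.deg (d' i))

theorem IsGradedFree.zero : IsGradedFree (zero 𝒜) :=
  ⟨Empty, Module.Basis.empty (M := PUnit.{u + 1}), Empty.elim, fun i => i.elim⟩

theorem IsGradedFree.projective [IsNoetherianRing A] [GradedAlgebra 𝒜] {P : GrMod 𝒜}
    (h : IsGradedFree P) : Projective P where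
  factors {E X} f e he := by
    obtain ⟨ι, b, d, hb⟩ := h
    have hs := surjective_of_epi e
    choose y hy using fun i => hs (Hom.lin f (b i))
    -- An arbitrary preimage need not be homogeneous; its component of degree `d i` is still a
    -- preimage, since `e` commutes with projections.
    let g : P.carrier →ₗ[A] E.carrier := b.constr ℕ fun i => E.proj (d i) (y i)
    have hg : ∀ i, g (b i) = E.proj (d i) (y i) := fun i => b.constr_basis ℕ _ i
    refine ⟨Hom.mk g (map_mem_of_generators g b d hb (fun i => ?_) b.span_eq), ?_⟩
    · rw [hg]
      exact E.proj_mem _ _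
    · apply Hom.ext'
      refine b.ext fun i => ?_
      change Hom.lin e (g (b i)) = Hom.lin f (b i)
      rw [hg, map_proj _ (Hom.mem e), hy, X.proj_of_mem (Hom.mem f _ _ (hb i))]

section regular

/-- The homogeneous components of a non-negatively graded algebra, indexed by the integers. -/
def intPiece (𝒜 : ℕ → Submodule k A) (i : ℤ) : AddSubgroup A :=
  if 0 ≤ i then (𝒜 i.toNat).toAddSubgroup else ⊥

theorem mem_intPiece_natCast {a : A} {i : ℕ} : a ∈ intPiece 𝒜 (i : ℤ) ↔ a ∈ 𝒜 i := by
  simp [intPiece]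

theorem eq_zero_of_mem_intPiece {a : A} {i : ℤ} (hi : i < 0) (h : a ∈ intPiece 𝒜 i) : a = 0 := by
  rwa [intPiece, if_neg (not_le.2 hi), AddSubgroup.mem_bot] at h

variable [GradedAlgebra 𝒜]

/-- The algebra as a graded module over itself. -/
noncomputable def regular (𝒜 : ℕ → Submodule k A) [GradedAlgebra 𝒜] : GrMod 𝒜 where
  carrier := A
  deg := intPiece 𝒜
  isInternal := by
    refine isInternal_of_proj _ (fun i => if 0 ≤ i then
      (GradedRing.proj 𝒜 i.toNat : A →+ A) else 0) ?_ ?_ ?_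
    · intro i x hx
      rcases lt_or_ge i 0 with hi | hi
      · rw [eq_zero_of_mem_intPiece hi hx, map_zero]
      · lift i to ℕ using hi
        rw [mem_intPiece_natCast] at hx
        simpa using DirectSum.decompose_of_mem_same 𝒜 hx
    · intro i j x hx hij
      rcases lt_or_ge i 0 with hi | hi
      · rw [eq_zero_of_mem_intPiece hi hx, map_zero]
      · lift i to ℕ using hi
        rw [mem_intPiece_natCast] at hx
        split_ifs with hj
        · lift j to ℕ using hj
          exact DirectSum.decompose_of_mem_ne 𝒜 hx (by simpa using hij)
        · rfl
    · intro x
      classical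
      rw [← DirectSum.sum_support_decompose 𝒜 x]
      exact sum_mem fun i _ => AddSubgroup.mem_iSup_of_mem (i : ℤ)
        (mem_intPiece_natCast.2 (SetLike.coe_mem _))
  smul_mem i j a m ha hm := by
    rcases lt_or_ge j 0 with hj | hj
    · rw [eq_zero_of_mem_intPiece hj hm, smul_zero]
      exact zero_mem _
    · lift j to ℕ using hj
      rw [mem_intPiece_natCast] at hm
      rw [← Nat.cast_add, mem_intPiece_natCast]
      exact SetLike.mul_mem_graded ha hm

theorem IsGradedFree.regular : IsGradedFree (regular 𝒜) :=
  ⟨Unit, Module.Basis.singleton Unit A, fun _ => 0, fun i => by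
    have h : Module.Basis.singleton Unit A i = 1 := Module.Basis.singleton_apply ..
    have h1 : (1 : A) ∈ intPiece 𝒜 ((0 : ℕ) : ℤ) :=
      mem_intPiece_natCast.2 SetLike.GradedOne.one_mem
    exact h ▸ h1⟩

end regular

/-- The graded module `M` vanishes in degrees below `a`. -/
def DegGE (M : GrMod 𝒜) (a : ℤ) : Prop := ∀ i < a, ∀ x ∈ M.deg i, x = 0

/-- The graded module `M` vanishes in degrees from `a` on. -/
def DegLT (M : GrMod 𝒜) (a : ℤ) : Prop := ∀ i, a ≤ i → ∀ x ∈ M.deg i, x = 0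

theorem DegGE.of_injective {M N : GrMod 𝒜} {a : ℤ} (h : N.DegGE a) (f : M ⟶ N)
    (hf : Function.Injective (Hom.lin f)) : M.DegGE a := fun i hi x hx =>
  hf ((h i hi _ (Hom.mem f i x hx)).trans (map_zero _).symm)

theorem hom_eq_zero_of_deg {M N : GrMod 𝒜} {a : ℤ} (hM : M.DegGE a) (hN : N.DegLT a)
    (f : M ⟶ N) : f = 0 := by
  apply Hom.ext'
  apply LinearMap.ext
  intro x
  obtain ⟨s, hs⟩ := M.exists_sum_proj x
  rw [hs, map_sum, lin_zero, LinearMap.zero_apply]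
  refine Finset.sum_eq_zero fun i _ => ?_
  rcases lt_or_ge i a with hi | hi
  · rw [hM i hi _ (M.proj_mem i x), map_zero]
  · exact hN i hi _ (Hom.mem f i _ (M.proj_mem i x))

theorem span_homogeneous (M : GrMod 𝒜) :
    Submodule.span A {x | ∃ i, x ∈ M.deg i} = ⊤ := by
  refine eq_top_iff.2 fun x _ => ?_
  obtain ⟨s, hs⟩ := M.exists_sum_proj x
  rw [hs]
  exact sum_mem fun i _ => Submodule.subset_span ⟨i, M.proj_mem i x⟩

/-- The map out of a shift of the regular module that picks a homogeneous element. -/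
noncomputable def ofElement [GradedAlgebra 𝒜] (M : GrMod 𝒜) {i : ℤ} {x : M.carrier}
    (hx : x ∈ M.deg i) : (regular 𝒜).shift i ⟶ M :=
  Hom.mk (M := (regular 𝒜).shift i) (LinearMap.toSpanSingleton A M.carrier x) fun j (a : A) ha => by
    change a ∈ intPiece 𝒜 (j - i) at ha
    change a • x ∈ M.deg j
    rcases lt_or_ge (j - i) 0 with hj | hj
    · rw [eq_zero_of_mem_intPiece hj ha, zero_smul]
      exact zero_mem _
    · obtain ⟨t, ht⟩ := Int.eq_ofNat_of_zero_le hj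
      rw [ht] at ha
      have := M.smul_mem t i a x (mem_intPiece_natCast.1 ha) hx
      rwa [← ht, sub_add_cancel] at this

/-- Every graded module is a quotient of a graded free module with the same lower bound on the
degrees. -/
theorem exists_graded_free_cover [GradedAlgebra 𝒜] (M : GrMod 𝒜) {a : ℤ} (hM : M.DegGE a) :
    ∃ (P : GrMod 𝒜) (f : P ⟶ M), P.IsGradedFree ∧ P.DegGE a ∧
      Function.Surjective (Hom.lin f) := by
  classical
  obtain ⟨S, hS, hS'⟩ := Submodule.fg_span_iff_fg_span_finset_subset _ |>.1
    (M.span_homogeneous ▸ Module.Finite.fg_top)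
  have key : ∀ T : Finset M.carrier, (T : Set M.carrier) ⊆ {x | ∃ i, x ∈ M.deg i} →
      ∃ (P : GrMod 𝒜) (f : P ⟶ M), P.IsGradedFree ∧ P.DegGE a ∧
        ∀ x ∈ T, x ∈ LinearMap.range (Hom.lin f) := by
    intro T
    induction T using Finset.induction_on with
    | empty => exact fun _ => ⟨zero 𝒜, 0, IsGradedFree.zero, fun _ _ _ _ => rfl, by simp⟩
    | insert x T _ ih =>
      intro hT
      rw [Finset.coe_insert, Set.insert_subset_iff] at hT
      obtain ⟨P, f, hP, hPa, hf⟩ := ih hT.2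
      obtain ⟨i, hi⟩ := hT.1
      -- A generator of degree below `a` is zero and needs no free summand, which keeps the cover in
      -- degrees ≥ `a`.
      rcases lt_or_ge i a with hia | hia
      · refine ⟨P, f, hP, hPa, fun y hy => ?_⟩
        rcases Finset.mem_insert.1 hy with rfl | hy
        · rw [hM i hia _ hi]
          exact zero_mem _
        · exact hf y hy
      · refine ⟨((regular 𝒜).shift i).prod P,
          Hom.mk (M := ((regular 𝒜).shift i).prod P)
            (LinearMap.coprod (Hom.lin (M.ofElement hi)) (Hom.lin f)) ?_,
          (IsGradedFree.regular.shift i).prod hP, ?_, ?_⟩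
        · rintro j ⟨y, z⟩ ⟨hy, hz⟩
          exact add_mem (Hom.mem (M.ofElement hi) j y hy) (Hom.mem f j z hz)
        · rintro j hj ⟨y, z⟩ ⟨hy, hz⟩
          exact Prod.ext (eq_zero_of_mem_intPiece (𝒜 := 𝒜) (i := j - i) (by omega) hy) (hPa j hj z hz)
        · intro y hy
          rcases Finset.mem_insert.1 hy with rfl | hy
          · refine ⟨((1 : A), 0), ?_⟩
            change (1 : A) • y + Hom.lin f 0 = y
            rw [one_smul, map_zero, add_zero]
          · obtain ⟨z, rfl⟩ := hf y hy
            refine ⟨(0, z), ?_⟩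
            change Hom.lin (M.ofElement hi) 0 + Hom.lin f z = _
            rw [map_zero, zero_add]
  obtain ⟨P, f, hP, hPa, hf⟩ := key S hS
  refine ⟨P, f, hP, hPa, LinearMap.range_eq_top.1 (eq_top_iff.2 ?_)⟩
  rw [← M.span_homogeneous, hS', Submodule.span_le]
  exact hf

end GrMod

/-! ### Graded Ext: degree bounds, shifts, inflation, truncation. -/

namespace GrMod

open Limits Abelian

variable {k : Type v} {A : Type u} [Field k] [Ring A] [Algebra k A] {𝒜 : ℕ → Submodule k A}
  [GradedAlgebra 𝒜]

section Ext

variable [IsNoetherianRing A]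

theorem IsGradedFree.ext_subsingleton {P : GrMod 𝒜} (h : IsGradedFree P) (N : GrMod 𝒜) {n : ℕ}
    (hn : 0 < n) : Subsingleton (Ext.{u + 1} P N n) := by
  have := h.projective
  obtain ⟨n, rfl⟩ := Nat.exists_eq_succ_of_ne_zero hn.ne'
  exact Ext.subsingleton_of_projective P N n

/-- As A is non-negatively graded, all syzygies of M can be taken in degrees ≥ `a`, where there are
no nonzero maps to N. -/
theorem ext_subsingleton_of_deg {M N : GrMod 𝒜} {a : ℤ} (hM : M.DegGE a) (hN : N.DegLT a)
    (n : ℕ) : Subsingleton (Ext.{u + 1} M N n) := by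
  induction n generalizing M with
  | zero => exact ext_zero_subsingleton (hom_eq_zero_of_deg hM hN)
  | succ n ih =>
    obtain ⟨P, f, hP, hPa, hf⟩ := M.exists_graded_free_cover hM
    exact ext_subsingleton_right (shortExact_ker hf)
      (ih (hPa.of_injective (kerι f) Subtype.val_injective))
      (hP.ext_subsingleton N (Nat.succ_pos n))

/-- Shifting a graded free cover gives a graded free cover, so dimension shifting reduces to Ext¹,
where the extension of maps can be shifted and unshifted by hand. -/
theorem ext_shift_subsingleton {M N : GrMod 𝒜} {a : ℤ} (hM : M.DegGE a) (r : ℤ) {n : ℕ}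
    (hn : 0 < n) (h : Subsingleton (Ext.{u + 1} M N n)) :
    Subsingleton (Ext.{u + 1} (M.shift r) (N.shift r) n) := by
  induction n, hn using Nat.le_induction generalizing M with
  | base =>
    obtain ⟨P, f, hP, hPa, hf⟩ := M.exists_graded_free_cover hM
    have hS := shortExact_of_exact (f := Hom.shift (kerι f) r) (g := Hom.shift f r)
      (LinearMap.exact_subtype_ker_map (Hom.lin f)) Subtype.val_injective hf
    refine ext_one_subsingleton_of_extension hS ((hP.shift r).ext_subsingleton _ one_pos) ?_
    intro g
    obtain ⟨l, hl⟩ := exists_extension_of_ext_one (shortExact_ker hf) h (Hom.unshift g)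
    refine ⟨Hom.shift l r, Hom.ext' (LinearMap.ext fun x => ?_)⟩
    exact LinearMap.congr_fun (congrArg Hom.lin hl) x
  | succ n hn ih =>
    obtain ⟨P, f, hP, hPa, hf⟩ := M.exists_graded_free_cover hM
    have hS := shortExact_of_exact (f := Hom.shift (kerι f) r) (g := Hom.shift f r)
      (LinearMap.exact_subtype_ker_map (Hom.lin f)) Subtype.val_injective hf
    refine ext_subsingleton_right hS (ih (hPa.of_injective (kerι f) Subtype.val_injective) ?_)
      ((hP.shift r).ext_subsingleton _ (Nat.succ_pos n))
    exact ext_subsingleton_left (shortExact_ker hf) (hP.ext_subsingleton N hn) h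

end Ext

/-! #### Inflation -/

section inflate

theorem degGE_inflate (X : FGModuleCat.{u} (𝒜 0)) : (inflate X).DegGE 0 := by
  intro i hi (x : X) hx
  change x ∈ (if i = 0 then ⊤ else ⊥ : AddSubgroup X) at hx
  rwa [if_neg hi.ne, AddSubgroup.mem_bot] at hx

theorem degLT_inflate_shift (X : FGModuleCat.{u} (𝒜 0)) {j a : ℤ} (h : j < a) :
    ((inflate X).shift j).DegLT a := by
  intro i hi (x : X) hx
  change x ∈ (if i - j = 0 then ⊤ else ⊥ : AddSubgroup X) at hx
  rwa [if_neg (by omega), AddSubgroup.mem_bot] at hx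

/-- The morphism of graded modules induced by a linear map over the degree zero part. -/
noncomputable def inflateHom {X Y : FGModuleCat.{u} (𝒜 0)} (f : X →ₗ[𝒜 0] Y) :
    inflate X ⟶ inflate Y :=
  Hom.mk (M := inflate X) (N := inflate Y)
    { toFun := f
      map_add' := map_add f
      map_smul' := fun a (x : X) => f.map_smul (GradedRing.projZeroRingHom' 𝒜 a) x }
    (by
      intro i (x : X) hx
      change x ∈ (if i = 0 then ⊤ else ⊥ : AddSubgroup X) at hx
      change f x ∈ (if i = 0 then ⊤ else ⊥ : AddSubgroup Y)
      split_ifs at hx ⊢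
      · trivial
      · rw [AddSubgroup.mem_bot] at hx ⊢
        rw [hx, map_zero])

/-- The linear map over the degree zero part underlying a morphism between inflated modules. -/
noncomputable def deflateHom {X Y : FGModuleCat.{u} (𝒜 0)} (g : inflate X ⟶ inflate Y) :
    X →ₗ[𝒜 0] Y where
  toFun := Hom.lin g
  map_add' := map_add (Hom.lin g)
  map_smul' a x := by
    have h : ∀ z : (inflate X).carrier, Hom.lin g ((a : A) • z) = (a : A) • Hom.lin g z :=
      (Hom.lin g).map_smul (a : A)
    have h' : Hom.lin g (GradedRing.projZeroRingHom' 𝒜 (a : A) • x) =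
      (GradedRing.projZeroRingHom' 𝒜 (a : A) • (id (Hom.lin g x) : Y) : Y) := h x
    rwa [GradedRing.projZeroRingHom'_apply_coe] at h'

theorem isZero_inflate (X : FGModuleCat.{u} (𝒜 0)) [h : Subsingleton X] :
    IsZero (inflate X) := by
  rw [IsZero.iff_id_eq_zero]
  exact Hom.ext' (LinearMap.ext fun x => h.elim _ _)

variable [IsNoetherianRing A]

theorem shortExact_inflate {X Y Z : FGModuleCat.{u} (𝒜 0)} {f : X →ₗ[𝒜 0] Y} {g : Y →ₗ[𝒜 0] Z}
    (h : Function.Exact f g) (hf : Function.Injective f) (hg : Function.Surjective g) :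
    (complexOfExact (inflateHom f) (inflateHom g) h).ShortExact :=
  shortExact_of_exact (f := inflateHom f) (g := inflateHom g) h hf hg

theorem shortExact_inflate_ker [IsNoetherianRing (𝒜 0)] {P X : FGModuleCat.{u} (𝒜 0)}
    {p : P →ₗ[𝒜 0] X} (hp : Function.Surjective p) :
    (complexOfExact (inflateHom (X := FGModuleCat.ofSub (LinearMap.ker p))
      (LinearMap.ker p).subtype) (inflateHom p)
      (LinearMap.exact_subtype_ker_map p)).ShortExact :=
  shortExact_inflate (X := FGModuleCat.ofSub (LinearMap.ker p)) _ Subtype.val_injective hp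

/-- Inflation of an isomorphism. -/
noncomputable def inflateIso {X Y : FGModuleCat.{u} (𝒜 0)} (e : X ≃ₗ[𝒜 0] Y) :
    inflate X ≅ inflate Y where
  hom := inflateHom e.toLinearMap
  inv := inflateHom e.symm.toLinearMap
  hom_inv_id := Hom.ext' (LinearMap.ext e.symm_apply_apply)
  inv_hom_id := Hom.ext' (LinearMap.ext e.apply_symm_apply)

theorem hasFiltration_ext_inflate_subsingleton [IsNoetherianRing (𝒜 0)] {Λ : Type w}
    {D : Λ → FGModuleCat.{u} (𝒜 0)} {T : Set Λ} {X : FGModuleCat.{u} (𝒜 0)} {N : GrMod 𝒜} {n : ℕ}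
    (hX : HasFiltration D T X) (h : ∀ ν ∈ T, Subsingleton (Ext.{u + 1} (inflate (D ν)) N n)) :
    Subsingleton (Ext.{u + 1} (inflate X) N n) := by
  refine FGModuleCat.HasFiltration.induction
    (P := fun X => Subsingleton (Ext.{u + 1} (inflate X) N n)) ?_ ?_ ?_ X hX
  · intro X _
    exact ext_subsingleton_of_isZero (isZero_inflate X) n
  · rintro X X' ⟨e⟩ hX
    exact ext_subsingleton_of_iso_left (inflateIso e) hX
  · intro X X' ν f g hν hf hg hfg hX
    exact ext_subsingleton_middle (shortExact_inflate hfg hf hg) hX (h ν hν)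

/-- First extensions over the degree zero part embed into graded first extensions. -/
theorem ext_one_subsingleton_of_inflate [IsNoetherianRing (𝒜 0)]
    [HasExt.{u + 1} (FGModuleCat.{u} (𝒜 0))] {X Y : FGModuleCat.{u} (𝒜 0)}
    (h : Subsingleton (Ext.{u + 1} (inflate X) (inflate Y) 1)) :
    Subsingleton (Ext.{u + 1} X Y 1) := by
  obtain ⟨P, p, hP, hp⟩ := FGModuleCat.exists_projective_cover X
  refine ext_one_subsingleton_of_extension (FGModuleCat.shortExact_ker hp)
    (FGModuleCat.ext_subsingleton_of_projective P Y hP one_pos) fun f => ?_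
  -- Maps between modules in degree 0 are the same over A and over A_0, so an extension found over A
  -- is one over A_0.
  obtain ⟨g, hg⟩ := exists_extension_of_ext_one (shortExact_inflate_ker hp) h
    (inflateHom (FGModuleCat.linOfHom f))
  refine ⟨FGModuleCat.homOfLin (deflateHom g), FGModuleCat.hom_ext (LinearMap.ext fun x => ?_)⟩
  exact LinearMap.congr_fun (congrArg Hom.lin hg) x

end inflate

/-! #### Truncations -/

/-- The submodule of elements without components in degrees below `t`. -/
def geSubmodule (M : GrMod 𝒜) (t : ℤ) : Submodule A M.carrier where
  carrier := {x | ∀ i < t, M.proj i x = 0}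
  zero_mem' i _ := map_zero _
  add_mem' hx hy i hi := by rw [map_add, hx i hi, hy i hi, add_zero]
  smul_mem' a x hx i hi := by
    induction a using DirectSum.Decomposition.inductionOn 𝒜 with
    | zero => simp
    | homogeneous a => rw [M.proj_smul a.2, hx _ (by omega), smul_zero]
    | add a b ha hb => rw [add_smul, map_add, ha, hb, add_zero]

theorem geSubmodule_mono (M : GrMod 𝒜) {s t : ℤ} (h : s ≤ t) :
    M.geSubmodule t ≤ M.geSubmodule s := fun _ hx i hi => hx i (hi.trans_le h)

theorem proj_regular_mem (t : ℕ) (x : A) : (regular 𝒜).proj t x ∈ 𝒜 t :=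
  (mem_intPiece_natCast (𝒜 := 𝒜)).1 ((regular 𝒜).proj_mem t x)

theorem degGE_regular : (regular 𝒜).DegGE 0 := fun _ hi _ hx =>
  eq_zero_of_mem_intPiece (𝒜 := 𝒜) hi hx

variable [IsNoetherianRing A]

/-- The truncation of a graded module to degrees at least `t`. -/
noncomputable def ge (M : GrMod 𝒜) (t : ℤ) : GrMod 𝒜 := M.sub (M.geSubmodule t) (by
  intro i x hx j hj
  by_cases hij : i = j
  · subst hij
    rw [hx i hj, map_zero]
  · exact M.proj_of_mem_ne (M.proj_mem i x) hij)

theorem degGE_ge (M : GrMod 𝒜) (t : ℤ) : (M.ge t).DegGE t := fun i hi x hx =>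
  Subtype.ext ((M.proj_of_mem (x := x.1) hx).symm.trans (x.2 i hi))

/-- Truncation does nothing to a module that vanishes in low degrees. -/
noncomputable def geIso {M : GrMod 𝒜} {t : ℤ} (h : M.DegGE t) : M.ge t ≅ M :=
  isoOfLin (M := M.ge t) (LinearEquiv.ofTop (M.geSubmodule t)
    (eq_top_iff.2 fun x _ i hi => h i hi _ (M.proj_mem i x))) fun _ _ => Iff.rfl

/-- The inclusion between truncations. -/
noncomputable def geι (M : GrMod 𝒜) {s t : ℤ} (h : s ≤ t) : M.ge t ⟶ M.ge s :=
  Hom.mk (M := M.ge t) (N := M.ge s) (Submodule.inclusion (M.geSubmodule_mono h))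
    fun _ _ hx => hx

end GrMod

/-! ### The components A_t as subquotients of A. -/

namespace GrMod

open Abelian

variable {k : Type v} {A : Type u} [Field k] [Ring A] [Algebra k A] [FiniteDimensional k A]
  (𝒜 : ℕ → Submodule k A) [GradedAlgebra 𝒜]

theorem projective_piece_zero : Module.Projective (𝒜 0) (piece 𝒜 0) := by
  let e : 𝒜 0 ≃ₗ[𝒜 0] piece 𝒜 0 :=
    { toFun := fun x => x
      invFun := fun x => x
      map_add' := fun _ _ => rfl
      map_smul' := fun _ _ => rfl
      left_inv := fun _ => rfl
      right_inv := fun _ => rfl }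
  exact Module.Projective.of_equiv e

variable [IsNoetherianRing A]

/-- The projection from the truncation `A_{≥ t}` to its lowest component `A_t`. -/
noncomputable def toPiece (t : ℕ) : (regular 𝒜).ge t ⟶ (inflate (piece 𝒜 t)).shift t :=
  Hom.mk (M := (regular 𝒜).ge t) (N := (inflate (piece 𝒜 t)).shift t)
    { toFun := fun x => (⟨(regular 𝒜).proj t x.1, proj_regular_mem (𝒜 := 𝒜) t x.1⟩ : 𝒜 t)
      map_add' := fun x y => Subtype.ext (map_add ((regular 𝒜).proj t) x.1 y.1)
      map_smul' := fun a x => by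
        refine Subtype.ext (show (regular 𝒜).proj t (a • x.1) =
          (GradedRing.projZeroRingHom 𝒜 a : A) • (regular 𝒜).proj t x.1 from ?_)
        induction a using DirectSum.Decomposition.inductionOn 𝒜 with
        | zero => rw [zero_smul, map_zero, map_zero, zero_smul]
        | @homogeneous i a =>
          rw [proj_smul _ a.2]
          by_cases hi : i = 0
          · subst hi
            rw [GradedRing.projZeroRingHom_apply, DirectSum.decompose_of_mem_same 𝒜 a.2]
            simp
          -- A scalar of positive degree i acts as zero on A_t, and the degree t component of `a •
          -- x` comes from degree t - i < t, where `x` has none.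
          · rw [GradedRing.projZeroRingHom_apply, DirectSum.decompose_of_mem_ne 𝒜 a.2 hi,
              zero_smul, x.2 _ (by omega), smul_zero]
        | add a b ha hb => rw [add_smul, map_add, ha, hb, map_add, add_smul] }
    (by
      intro i x hx
      change _ ∈ (if i - t = 0 then ⊤ else ⊥ : AddSubgroup (piece 𝒜 t))
      split_ifs with h
      · trivial
      · exact Subtype.ext ((regular 𝒜).proj_of_mem_ne (x := x.1) hx (by omega)))

theorem shortExact_toPiece (t : ℕ) :
    ∃ h : Function.Exact (Hom.lin ((regular 𝒜).geι (s := t) (t := (t + 1 : ℕ)) (by omega)))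
        (Hom.lin (toPiece 𝒜 t)),
      (complexOfExact ((regular 𝒜).geι (s := t) (t := (t + 1 : ℕ)) (by omega))
      (toPiece 𝒜 t) h).ShortExact := by
  refine ⟨fun x => ⟨fun hx => ?_, ?_⟩, shortExact_of_exact _ ?_ ?_⟩
  · refine ⟨⟨x.1, fun i hi => ?_⟩, rfl⟩
    rcases (Int.lt_add_one_iff.1 (by exact_mod_cast hi) : i ≤ t).lt_or_eq with hi | rfl
    · exact x.2 i hi
    · exact congrArg Subtype.val hx
  · rintro ⟨y, rfl⟩
    exact Subtype.ext (y.2 t (by omega))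
  · exact Submodule.inclusion_injective (geSubmodule_mono _ (by omega))
  · intro (y : 𝒜 t)
    have hy : (y : A) ∈ (regular 𝒜).deg t := mem_intPiece_natCast.2 y.2
    refine ⟨⟨y.1, fun i hi => (regular 𝒜).proj_of_mem_ne hy hi.ne'⟩, ?_⟩
    exact Subtype.ext ((regular 𝒜).proj_of_mem hy)

end GrMod

/-! ### Comparing Ext over A_0 and A, and the induction on s. -/

namespace IsQKoszul

open Abelian GrMod

variable {k : Type v} {A : Type u} [Field k] [Ring A] [Algebra k A] [FiniteDimensional k A]
  {𝒜 : ℕ → Submodule k A} [GradedAlgebra 𝒜] {Λ : Type w} [PartialOrder Λ]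
  {L Δ nab : Λ → FGModuleCat.{u} (𝒜 0)} {N : ℕ}

theorem ext_inflate_of_hasFiltration (hA : IsQKoszul 𝒜 N L Δ nab)
    {X : FGModuleCat.{u} (𝒜 0)} (hX : HasFiltration Δ Set.univ X) {i : ℕ} {j : ℤ} (hi : 0 < i)
    (hiN : i ≤ N) (hij : (i : ℤ) ≠ j) (ν : Λ) :
    Subsingleton (ExtGr i (inflate X) ((inflate (nab ν)).shift j)) := by
  have : IsNoetherianRing A := IsNoetherianRing.of_finite k A
  refine hasFiltration_ext_inflate_subsingleton hX fun μ _ => ?_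
  rw [← not_nontrivial_iff_subsingleton]
  exact fun h => hij (hA.ext_ne_zero μ ν i j hi hiN h)

variable [IsNoetherianRing A]

theorem ext_standard_one (hA : IsQKoszul 𝒜 N L Δ nab) (hN : 0 < N) (μ ν : Λ) :
    Subsingleton (ExtZero 𝒜 1 (Δ μ) (nab ν)) := by
  refine ext_one_subsingleton_of_inflate
    (ext_subsingleton_of_iso_right (shiftZeroIso (inflate (nab ν))) ?_)
  rw [← not_nontrivial_iff_subsingleton]
  intro h
  simpa using hA.ext_ne_zero μ ν 1 0 one_pos hN h

variable [IsArtinianRing (𝒜 0)]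

/-- This lets inflated A_0-projectives replace projective A-modules in dimension shifting: their
graded ext into ∇⟨j⟩ is confined to degree j in the range 0 < i ≤ N. -/
theorem hasFiltration_of_projective (hA : IsQKoszul 𝒜 N L Δ nab) (hN : 0 < N)
    (P : FGModuleCat.{u} (𝒜 0)) (hP : Module.Projective (𝒜 0) P) :
    HasFiltration Δ Set.univ P :=
  hA.quasiHereditary.hasFiltration_of_ext_one (hA.ext_standard_one hN) P fun ν =>
    FGModuleCat.ext_subsingleton_of_projective P (nab ν) hP one_pos

/-- Vanishing of extensions over the degree zero part gives vanishing of graded extensions. -/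
theorem ext_inflate_of_ext (hA : IsQKoszul 𝒜 N L Δ nab) {q : ℕ} (hq : 0 < q)
    (V : FGModuleCat.{u} (𝒜 0)) (h : ∀ ν, Subsingleton (ExtZero 𝒜 q V (nab ν)))
    {p : ℕ} {m : ℤ} (hqp : q ≤ p) (hpN : p ≤ N) (hm : m + q ≤ p) (ν : Λ) :
    Subsingleton (ExtGr p (inflate V) ((inflate (nab ν)).shift m)) := by
  have hN : 0 < N := by omega
  induction q, hq using Nat.le_induction generalizing V p with
  | base =>
    -- For `q = 1` the module is Δ-filtered, and `m + 1 ≤ p` excludes the diagonal `p = m`.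
    exact hA.ext_inflate_of_hasFiltration
      (hA.quasiHereditary.hasFiltration_of_ext_one (hA.ext_standard_one hN) V h) hqp hpN
      (by push_cast at hm; omega) ν
  | succ q hq ih =>
    obtain ⟨P, g, hP, hg⟩ := FGModuleCat.exists_projective_cover V
    obtain ⟨p, rfl⟩ := Nat.exists_eq_succ_of_ne_zero (by omega : p ≠ 0)
    -- Passing to the kernel lowers `q` and `p` by one and keeps `m`, so the bound `m + q ≤ p` is
    -- preserved.
    refine ext_subsingleton_right (shortExact_inflate_ker hg)
      (ih _ (fun κ => ?_) (by omega) (by omega) (by push_cast at hm; omega))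
      (hA.ext_inflate_of_hasFiltration (hA.hasFiltration_of_projective hN P hP)
        (Nat.succ_pos p) hpN (by push_cast at hm ⊢; omega) ν)
    exact ext_subsingleton_left (FGModuleCat.shortExact_ker hg)
      (FGModuleCat.ext_subsingleton_of_projective P _ hP hq) (h κ)

/-- Vanishing of graded extensions in degree zero gives vanishing over the degree zero part. -/
theorem ext_of_ext_inflate (hA : IsQKoszul 𝒜 N L Δ nab) {q : ℕ} (hq : 0 < q) (hqN : q ≤ N)
    (V : FGModuleCat.{u} (𝒜 0)) (ν : Λ)
    (h : Subsingleton (ExtGr q (inflate V) (inflate (nab ν)))) :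
    Subsingleton (ExtZero 𝒜 q V (nab ν)) := by
  have hN : 0 < N := by omega
  induction q, hq using Nat.le_induction generalizing V with
  | base => exact ext_one_subsingleton_of_inflate h
  | succ q hq ih =>
    obtain ⟨P, g, hP, hg⟩ := FGModuleCat.exists_projective_cover V
    refine ext_subsingleton_right (FGModuleCat.shortExact_ker hg) (ih (by omega) _ ?_)
      (FGModuleCat.ext_subsingleton_of_projective P _ hP (Nat.succ_pos q))
    -- The graded vanishing descends to the kernel because ext^q_A(P, ∇⟨0⟩) = 0 for `q > 0`.
    refine ext_subsingleton_left (shortExact_inflate_ker hg)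
      (ext_subsingleton_of_iso_right (shiftZeroIso (inflate (nab ν))) ?_) h
    exact hA.ext_inflate_of_hasFiltration (hA.hasFiltration_of_projective hN P hP) hq
      (by omega) (by omega) ν

/-- Graded extensions of the shifted component `A_s` by shifted costandard modules. -/
theorem ext_piece_shift (hA : IsQKoszul 𝒜 N L Δ nab) {s p : ℕ} (hs : 0 < s) (hsp : s ≤ p)
    (hpN : p ≤ N) (h : ∀ ν, Subsingleton (ExtZero 𝒜 s (piece 𝒜 s) (nab ν))) {m : ℤ}
    (hm : m ≤ p) (ν : Λ) :
    Subsingleton (ExtGr p ((inflate (piece 𝒜 s)).shift s) ((inflate (nab ν)).shift m)) :=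
  -- After removing the shift by `s` the target is ∇⟨m - s⟩, and `(m - s) + s ≤ p` is the bound
  -- required for `q = s`.
  ext_subsingleton_of_iso_right (shiftShiftIso _ (m - s) s m (by omega))
    (ext_shift_subsingleton (degGE_inflate _) s (hs.trans_le hsp)
      (hA.ext_inflate_of_ext hs _ h hsp hpN (by omega) ν))

/-- Induction on t from the free module A = A_{≥0}. Passing from A_{≥t} to A_{≥t+1} is obstructed by
ext^{s+1}(A_t, ∇⟨s⟩): for t = 0 this vanishes since A_0 is projective over itself and s + 1 ≠ s, for
0 < t < s by the assumed vanishing over A_0. -/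
theorem ext_ge_regular (hA : IsQKoszul 𝒜 N L Δ nab) {s : ℕ} (hs : 0 < s) (hsN : s < N)
    (h : ∀ t, 0 < t → t < s → ∀ ν, Subsingleton (ExtZero 𝒜 t (piece 𝒜 t) (nab ν)))
    {t : ℕ} (ht : t ≤ s) (ν : Λ) :
    Subsingleton (ExtGr s ((regular 𝒜).ge t) ((inflate (nab ν)).shift s)) := by
  induction t with
  | zero =>
    exact ext_subsingleton_of_iso_left (geIso degGE_regular).symm
      (IsGradedFree.regular.ext_subsingleton _ hs)
  | succ t ih =>
    obtain ⟨he, hS⟩ := shortExact_toPiece 𝒜 t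
    refine ext_subsingleton_left hS (ih (by omega)) ?_
    rcases Nat.eq_zero_or_pos t with rfl | ht0
    · refine ext_subsingleton_of_iso_left (shiftZeroIso (inflate (piece 𝒜 0))).symm ?_
      exact hA.ext_inflate_of_hasFiltration
        (hA.hasFiltration_of_projective (by omega) _ (projective_piece_zero 𝒜))
        (Nat.succ_pos s) hsN (by push_cast; omega) ν
    · exact hA.ext_piece_shift ht0 (by omega) hsN (h t ht0 (by omega)) (by push_cast; omega) ν

theorem ext_piece (hA : IsQKoszul 𝒜 N L Δ nab) {s : ℕ} (hs : 0 < s) (hsN : s < N) (ν : Λ) :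
    Subsingleton (ExtZero 𝒜 s (piece 𝒜 s) (nab ν)) := by
  induction s using Nat.strong_induction_on generalizing ν with
  | _ s ih =>
    refine hA.ext_of_ext_inflate hs hsN.le _ ν ?_
    obtain ⟨he, hS⟩ := shortExact_toPiece 𝒜 s
    have h1 := hA.ext_ge_regular hs hsN (fun t ht hts ν => ih t hts ht (hts.trans hsN) ν) le_rfl ν
    have h2 : Subsingleton
        (ExtGr s ((inflate (piece 𝒜 s)).shift s) ((inflate (nab ν)).shift s)) := by
      obtain ⟨s, rfl⟩ := Nat.exists_eq_succ_of_ne_zero hs.ne'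
      -- A_{≥s+1} starts one degree above the only degree of ∇⟨s⟩, so its ext^{s-1} vanishes and
      -- ext^s(A_s, ∇⟨s⟩) embeds in ext^s(A_{≥s}, ∇⟨s⟩) = 0.
      exact ext_subsingleton_right hS (ext_subsingleton_of_deg (degGE_ge _ _)
        (degLT_inflate_shift _ (by push_cast; omega)) s) h1
    have h3 := ext_shift_subsingleton (a := s) ?_ (-s) hs h2
    · have e : ∀ X : GrMod 𝒜, (X.shift s).shift (-s) ≅ X := fun X =>
        shiftShiftIso X s (-s) 0 (by omega) ≪≫ shiftZeroIso X
      exact ext_subsingleton_of_iso_right (e _) (ext_subsingleton_of_iso_left (e _) h3)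
    · exact fun i hi x hx => degGE_inflate (piece 𝒜 s) (i - s) (by omega) x hx

end IsQKoszul

theorem mainTheorem8 {k : Type v} {A : Type u} [Field k] [IsAlgClosed k] [Ring A] [Algebra k A]
    [FiniteDimensional k A] (𝒜 : ℕ → Submodule k A) [GradedAlgebra 𝒜]
    {Λ : Type w} [PartialOrder Λ] (L Δ nab : Λ → FGModuleCat.{u} (𝒜 0))
    (n : ℕ) (hn : 0 < n) (hA : IsQKoszul 𝒜 (n + 1) L Δ nab)
    (s r : ℕ) (hs : 0 < s) (hsn : s ≤ n) (hsr : s ≤ r) :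
    (∀ γ, Subsingleton (ExtZero 𝒜 r (piece 𝒜 s) (nab γ))) ∧
    (∀ (j : ℕ) (W : FGModuleCat.{u} (𝒜 0)), r - 1 ≤ j → IsSyzygy (piece 𝒜 s) j W →
      HasFiltration Δ Set.univ W) ∧
    (∀ (j : ℕ) (W : FGModuleCat.{u} (𝒜 0)), s - 1 ≤ j → IsSyzygy (piece 𝒜 s) j W →
      HasFiltration Δ Set.univ W) ∧
    (r ≤ n + 1 → ∀ m : ℤ, m ≤ r → ∀ ν, Subsingleton
      (ExtGr r ((GrMod.inflate (piece 𝒜 s)).shift s) ((GrMod.inflate (nab ν)).shift m))) := by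
  have : IsNoetherianRing A := IsNoetherianRing.of_finite k A
  have : IsArtinianRing (𝒜 0) :=
    haveI : IsScalarTower k (𝒜 0) (𝒜 0) :=
      ⟨fun c a b => Subtype.ext (smul_mul_assoc c (a : A) (b : A))⟩
    IsArtinianRing.of_finite k (𝒜 0)
  have hQ := hA.quasiHereditary
  have h1 := hA.ext_standard_one (Nat.succ_pos n)
  have hp := hA.ext_piece hs (Nat.lt_succ_of_le hsn)
  have hF : ∀ (j : ℕ) (W : FGModuleCat.{u} (𝒜 0)), s - 1 ≤ j → IsSyzygy (piece 𝒜 s) j W →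
      HasFiltration Δ Set.univ W := fun j W hj hW => hQ.hasFiltration_syzygy h1 hs hj hp hW
  exact ⟨hQ.ext_costandard_of_le h1 hs hsr _ hp, fun j W hj => hF j W (by omega), hF,
    fun hr m hm ν => hA.ext_piece_shift hs hsr hr hp hm ν⟩
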